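/- **Setting.** Let $\Omega\subset\mathbb R^2$ be a bounded open set, $\varepsilon,\beta>0$, and let $H,f$ be measurable with $0<H_*\le H\le H^*$ and $|f|\le f^*$ a.e. in $\Omega$. Write $\|\cdot\|$ and $(\cdot,\cdot)$ for the norm and inner product of $L^2(\Omega)$, $\|v\|_{1/H}^2=(H^{-1}v,v)$, $v^\perp=(-v_2,v_1)$, and $|\cdot|_k$ for the $H^k(\Omega)$ seminorm. Let $V$ be the space of all $v\in H(\mathrm{div};\Omega)$ with $v\cdot n=0$ on $\partial\Omega$ (that is, $(v,\nabla q)+(\nabla\cdot v,q)=0$ for all $q\in H^1(\Omega)$). *Damping.* $g:\overline\Omega\times\mathbb R^2\to\mathbb R^2$ is continuous and there is $M>0$ such that for all $x\in\Omega$ (suppressed in the notation): $(g(v)-g(w))\cdot(v-w)>0$ for $v\ne w$; $|v-w|^2\le M(g(v)-g(w))\cdot(v-w)$ and $|g(v)-g(w)|^2\le M(g(v)-g(w))\cdot(v-w)$ for $|v|,|w|\ge1$; and $|g(v)-g(w)|\le M|v-w|$ for all $v,w$. There is an increasing concave $J:[0,\infty)\to[0,\infty)$ with $J(0)=0$, $|v-w|^2+|g(v)-g(w)|^2\le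 J\big((v-w)\cdot(g(v)-g(w))\big)$ for $|v|,|w|\le1$, and $J(s)\le C_0s^\alpha$ for $s\ge 0$, where $C_0>0$, $\alpha\in(0,1)$. *Discretization.* Let $k\ge1$, $h>0$. $V_h\subset V$ and $W_h\subset L^2(\Omega)$ are finite-dimensional, $\nabla\cdot V_h=W_h$, $\pi$ is the $L^2$ projection onto $W_h$, and $\Pi:V\to V_h$ is a bounded linear projection with $(\nabla\cdot\Pi v,w_h)=(\pi\nabla\cdot v,w_h)$ for all $v\in V$, $w_h\in W_h$. The constants $C_\Pi,C_\pi,C_P>0$ are such that $\|v-\Pi v\|\le C_\Pi h^k|v|_k$ for $v\in V\cap H^k(\Omega)^2$; $\|\nabla\cdot v-\pi\nabla\cdot v\|\le C_\pi h^k|\nabla\cdot v|_k$ for $v\in V$ with $\nabla\cdot v\in H^k(\Omega)$; and $\|v_h\|_{1/H}\le C_P\|\nabla\cdot v_h\|_{1/H}$ for all $v_h\in V_h$ with $(H^{-1}v_h,s_h)=0$ for every $s_h\in V_h$ with $\nabla\cdot s_h=0$. *Solutions.* $\phi\in W^{2,1}_{\mathrm{loc}}([0,\infty);V)$ and $\phi_h\in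 W^{2,1}_{\mathrm{loc}}([0,\infty);V_h)$ satisfy, for a.e. $t\ge0$, $$\Big(\tfrac1H\phi_{tt},v\Big)+\Big(\tfrac f{H\varepsilon}\phi_t^\perp,v\Big)+\tfrac\beta{\varepsilon^2}(\nabla\cdot\phi,\nabla\cdot v)+(g(\phi_t),v)=(F,v)\qquad\forall v\in V,$$ respectively the same equation with $\phi_h$ in place of $\phi$ for all $v\in V_h$, where $F(t)\in L^2(\Omega)^2$. Put $u=\phi_t$, $\eta=-\nabla\cdot\phi$, $u_h=\phi_{h,t}$, $\eta_h=-\nabla\cdot\phi_h$, $\chi=\Pi u-u$, $\rho=\pi\eta-\eta$, $\theta_h=\Pi\phi-\phi_h$, and $$E(t)=\tfrac12\|\theta_{h,t}\|_{1/H}^2+\tfrac{\beta}{2\varepsilon^2}\|\nabla\cdot\theta_h\|^2 .$$ *Constants.* $$C_1=\frac1{H_*}\Big(2+\frac{3(f^*C_P)^2}{2\beta H_*}\Big),\qquad C_2=\frac{3(\varepsilon C_P)^2H^*}{2\beta H_*},$$ $$C_3=C_2+(C_1+C_2)|\Omega|+\tfrac{H^*}2(C_1+C_2)^2\big(2M+(2C_0)^{1/\alpha}\big)^2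 .$$ **Theorem.** Suppose that $\phi,\phi_t\in L^\infty(0,T;H^k(\Omega)^2)$ for every $T>0$, that for a.e. $t\ge 0$ one has $\phi_{tt}(t)\in H^k(\Omega)^2$ and $$\kappa(\phi):=\frac{C_\Pi}{H_*}|\phi_{tt}|_k+C_\Pi\Big(\frac{f^*}{H_*\varepsilon}+M\Big)|\phi_t|_k\le\bar\kappa ,$$ that $\bar\kappa h^k\le1$, and that $E(0)=0$. Then for all $t\ge0$ $$E(t)\le3C_3\,\bar\kappa^{\frac{2\alpha}{2-\alpha}}h^{\frac{2k\alpha}{2-\alpha}},$$ $$\tfrac12\|u-u_h\|^2+\tfrac\beta{2\varepsilon}\|\eta-\eta_h\|^2\le\|\chi\|^2+\tfrac\beta\varepsilon\|\rho\|^2+2\max(H^*,\varepsilon)\,E(t),$$ moreover $u(t)\in H^k(\Omega)^2$ and, whenever $\eta(t)\in H^k(\Omega)$, $$\|\chi\|^2+\tfrac\beta\varepsilon\|\rho\|^2+2\max(H^*,\varepsilon)E(t)\le\Big[C_\Pi^2|u|_k^2+\tfrac\beta\varepsilon C_\pi^2|\eta|_k^2\Big]h^{2k}+6\max(H^*,\varepsilon)\,C_3\,\bar\kappa^{\frac{2\alpha}{2-\alpha}}h^{\frac{2k\alpha}{2-\alpha}}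 .$$ In particular, if $k=1$, $\alpha=2/3$, $h\le1$ and $\eta(t)\in H^1(\Omega)$, then $$\Big(\tfrac12\|u-u_h\|^2+\tfrac\beta{2\varepsilon}\|\eta-\eta_h\|^2\Big)^{1/2}\le\Big(C_\Pi^2|u|_1^2+\tfrac\beta\varepsilon C_\pi^2|\eta|_1^2+6\max(H^*,\varepsilon)C_3\bar\kappa\Big)^{1/2}\sqrt h .$$ Finally, quadratic damping, $g(v)=|v|v$ for $|v|\le1$ and $g(v)=v$ for $|v|\ge1$, satisfies the damping assumptions with $\alpha=2/3$ (for suitable $M$, $C_0$, $J$). -/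

import Mathlib

open MeasureTheory Set
open scoped ContDiff

namespace Tide

noncomputable section

/-- The Euclidean plane. -/
abbrev E2 : Type := EuclideanSpace ℝ (Fin 2)

/-- Vector fields in `L²(Ω)`; the norm is the `L²` norm of the Euclidean length. -/
abbrev L2v (Ω : Set E2) : Type := Lp E2 2 (volume.restrict Ω)

/-- Scalar functions in `L²(Ω)`. -/
abbrev L2s (Ω : Set E2) : Type := Lp ℝ 2 (volume.restrict Ω)

/-- The `i`-th component of an `L²` vector field. -/
def comp {Ω : Set E2} (v : L2v Ω) (i : Fin 2) : L2s Ω :=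
  (EuclideanSpace.proj i : E2 →L[ℝ] ℝ).compLp v

/-! ### Sobolev spaces through weak derivatives -/

/-- The classical derivative `∂₁^a ∂₂^b ψ` of a smooth function. -/
def mpartial (a b : ℕ) (ψ : E2 → ℝ) (x : E2) : ℝ :=
  iteratedFDeriv ℝ (a + b) ψ x
    (fun j : Fin (a + b) => EuclideanSpace.single (if (j : ℕ) < a then (0 : Fin 2) else 1) (1 : ℝ))

/-- `w ∈ L²(Ω)` is the weak derivative `∂₁^a ∂₂^b q`, tested with `C_c^∞(Ω)`. -/
def HasWeakDeriv {Ω : Set E2} (a b : ℕ) (q w : L2s Ω) : Prop :=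
  ∀ ψ : E2 → ℝ, ContDiff ℝ ∞ ψ → HasCompactSupport ψ → tsupport ψ ⊆ Ω →
    ∫ x in Ω, q x * mpartial a b ψ x = (-1) ^ (a + b) * ∫ x in Ω, w x * ψ x

/-- `q ∈ H¹(Ω)` with weak gradient `G`. -/
def HasWeakGrad {Ω : Set E2} (q : L2s Ω) (G : L2v Ω) : Prop :=
  HasWeakDeriv 1 0 q (comp G 0) ∧ HasWeakDeriv 0 1 q (comp G 1)

/-- `q ∈ H^k(Ω)`: all weak derivatives of order at most `k` exist in `L²(Ω)`. -/
def MemHk {Ω : Set E2} (k : ℕ) (q : L2s Ω) : Prop :=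
  ∀ a b : ℕ, a + b ≤ k → ∃ w : L2s Ω, HasWeakDeriv a b q w

open Classical in
/-- The weak derivative `∂₁^a ∂₂^b q` (zero if it does not exist in `L²`). -/
def weakDeriv {Ω : Set E2} (a b : ℕ) (q : L2s Ω) : L2s Ω :=
  if hq : ∃ w : L2s Ω, HasWeakDeriv a b q w then hq.choose else 0

/-- The seminorm `|q|_k`, `|q|_k² = ∑_{a + b = k} ‖∂₁^a ∂₂^b q‖²`; it is only used for
`q ∈ H^k(Ω)`. -/
def seminormHk {Ω : Set E2} (k : ℕ) (q : L2s Ω) : ℝ :=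
  Real.sqrt (∑ a ∈ Finset.range (k + 1), ‖weakDeriv a (k - a) q‖ ^ 2)

/-- `v ∈ H^k(Ω)²`. -/
def VMemHk {Ω : Set E2} (k : ℕ) (v : L2v Ω) : Prop :=
  ∀ i : Fin 2, MemHk k (comp v i)

/-- The seminorm `|v|_k` of a vector field. -/
def vseminormHk {Ω : Set E2} (k : ℕ) (v : L2v Ω) : ℝ :=
  Real.sqrt (∑ i : Fin 2, seminormHk k (comp v i) ^ 2)

/-- The norm of `H^k(Ω)²`. -/
def vnormHk {Ω : Set E2} (k : ℕ) (v : L2v Ω) : ℝ :=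
  Real.sqrt (∑ j ∈ Finset.range (k + 1), vseminormHk j v ^ 2)

/-- `v ∈ L^∞(0, T; H^k(Ω)²)` for every `T > 0`. -/
def LinftyHk {Ω : Set E2} (k : ℕ) (v : ℝ → L2v Ω) : Prop :=
  ∀ T : ℝ, 0 < T → ∃ K : ℝ, ∀ᵐ t ∂(volume.restrict (Ioo 0 T)),
    VMemHk k (v t) ∧ vnormHk k (v t) ≤ K

/-! ### The space `H(div)` with vanishing normal component -/

/-- The space of fields in `H(div; Ω)` with `v · n = 0` on `∂Ω`, realised as the graph of the weak
divergence: the pairs `(v, ∇ · v)` with `(v, ∇q) + (∇ · v, q) = 0` for all `q ∈ H¹(Ω)`.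
(For every open `Ω` this is the closure of the compactly supported smooth fields in `H(div; Ω)`.) -/
def Hdiv (Ω : Set E2) : Submodule ℝ (L2v Ω × L2s Ω) where
  carrier := {p | ∀ (q : L2s Ω) (G : L2v Ω), HasWeakGrad q G →
    inner ℝ p.1 G + inner ℝ p.2 q = 0}
  zero_mem' := by
    intro q G _
    simp
  add_mem' := by
    intro p r hp hr q G hG
    have h1 := hp q G hG
    have h2 := hr q G hG
    simp only [Prod.fst_add, Prod.snd_add, inner_add_left]
    linarith
  smul_mem' := by
    intro c p hp q G hG
    have h1 := hp q G hG
    simp only [Prod.smul_fst, Prod.smul_snd, real_inner_smul_left]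
    rw [← mul_add, h1, mul_zero]

/-- The underlying `L²` vector field. -/
def fld {Ω : Set E2} (v : Hdiv Ω) : L2v Ω := v.1.1

/-- The weak divergence `∇ · v`. -/
def dvg {Ω : Set E2} (v : Hdiv Ω) : L2s Ω := v.1.2

/-! ### The damped, rotating wave equation -/

/-- Rotation by `π/2`: `v^⊥ = (-v₂, v₁)`. -/
def rot (v : E2) : E2 := !₂[-v 1, v 0]

/-- The weighted inner product `(w u, v) = ∫_Ω w u · v`. -/
def winner {Ω : Set E2} (w : E2 → ℝ) (u v : L2v Ω) : ℝ :=
  ∫ x in Ω, w x * inner ℝ (u x) (v x)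

/-- `φ' ∈ L¹_loc([0,∞))` is the time derivative of the locally absolutely continuous `φ`. -/
def IsTimeDeriv {X : Type*} [NormedAddCommGroup X] [NormedSpace ℝ X] (φ φ' : ℝ → X) : Prop :=
  ∀ t : ℝ, 0 ≤ t → IntervalIntegrable φ' volume 0 t ∧ φ t = φ 0 + ∫ s in (0 : ℝ)..t, φ' s

/-- `φ`, with `φ_t = φ₁` and `φ_tt = φ₂` (derivatives in the topology of `H(div)`), takes its values
in the subspace `S` of `H(div)` and solves, for almost every `t ≥ 0` and all `v ∈ S`,
`(H⁻¹ φ_tt, v) + ((f / (H ε)) φ_t^⊥, v) + (β / ε²) (∇ · φ, ∇ · v) + (g(φ_t), v) = (F, v)`.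
The case `S = ⊤` is the continuous problem, `S = V_h` the semidiscrete one. -/
structure IsSolution {Ω : Set E2} (S : Submodule ℝ (Hdiv Ω)) (H f : E2 → ℝ) (ε β : ℝ)
    (g : E2 → E2 → E2) (F : ℝ → L2v Ω) (φ φ₁ φ₂ : ℝ → Hdiv Ω) : Prop where
  mem : ∀ t : ℝ, 0 ≤ t → φ t ∈ S
  deriv_one : IsTimeDeriv (fun t => (φ t : L2v Ω × L2s Ω)) (fun t => (φ₁ t : L2v Ω × L2s Ω))
  deriv_two : IsTimeDeriv (fun t => (φ₁ t : L2v Ω × L2s Ω)) (fun t => (φ₂ t : L2v Ω × L2s Ω))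
  eqn : ∀ᵐ t ∂(volume.restrict (Ici (0 : ℝ))), ∀ v ∈ S,
    winner (fun x => 1 / H x) (fld (φ₂ t)) (fld v)
      + (∫ x in Ω, f x / (H x * ε) * inner ℝ (rot (fld (φ₁ t) x)) (fld v x))
      + β / ε ^ 2 * inner ℝ (dvg (φ t)) (dvg v)
      + (∫ x in Ω, inner ℝ (g x (fld (φ₁ t) x)) (fld v x))
      = inner ℝ (F t) (fld v)

/-- The energy `½ ‖v‖²_{1/H} + (β / (2 ε²)) ‖∇ · θ‖²` (used with `v = θ_t`). -/
def energy {Ω : Set E2} (H : E2 → ℝ) (ε β : ℝ) (v θ : Hdiv Ω) : ℝ :=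
  1 / 2 * winner (fun x => 1 / H x) (fld v) (fld v) + β / (2 * ε ^ 2) * ‖dvg θ‖ ^ 2

/-! ### Assumptions on coefficients and damping -/

/-- Bounds on the coefficients: `0 < H_* ≤ H ≤ H^*` and `|f| ≤ f^*` almost everywhere in `Ω`. -/
structure CoeffBounds (Ω : Set E2) (H f : E2 → ℝ) (Hlo Hhi fmax : ℝ) : Prop where
  meas_H : AEMeasurable H (volume.restrict Ω)
  meas_f : AEMeasurable f (volume.restrict Ω)
  lo_pos : 0 < Hlo
  lo_le_hi : Hlo ≤ Hhi
  fmax_nonneg : 0 ≤ fmax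
  H_mem : ∀ᵐ x ∂(volume.restrict Ω), Hlo ≤ H x ∧ H x ≤ Hhi
  f_le : ∀ᵐ x ∂(volume.restrict Ω), |f x| ≤ fmax

/-- Structural assumptions on the damping: continuity, strict monotonicity, linear growth of
differences outside the unit ball, and the Lipschitz condition. -/
structure Damping (Ω : Set E2) (g : E2 → E2 → E2) (M : ℝ) : Prop where
  M_pos : 0 < M
  cont : ContinuousOn (fun p : E2 × E2 => g p.1 p.2) (closure Ω ×ˢ univ)
  mono : ∀ x ∈ Ω, ∀ v w : E2, v ≠ w → 0 < inner ℝ (g x v - g x w) (v - w)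
  growth : ∀ x ∈ Ω, ∀ v w : E2, 1 ≤ ‖v‖ → 1 ≤ ‖w‖ →
    ‖v - w‖ ^ 2 ≤ M * inner ℝ (g x v - g x w) (v - w) ∧
    ‖g x v - g x w‖ ^ 2 ≤ M * inner ℝ (g x v - g x w) (v - w)
  lipschitz : ∀ x ∈ Ω, ∀ v w : E2, ‖g x v - g x w‖ ≤ M * ‖v - w‖

/-- An increasing concave `J : [0,∞) → [0,∞)` with `J(0) = 0` that controls differences inside the
unit ball, and satisfies `J(s) ≤ C₀ s^α`. -/
structure DampingProfile (Ω : Set E2) (g : E2 → E2 → E2) (J : ℝ → ℝ) (C₀ α : ℝ) : Prop where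
  C₀_pos : 0 < C₀
  α_pos : 0 < α
  α_lt_one : α < 1
  zero : J 0 = 0
  mono : MonotoneOn J (Ici 0)
  concave : ConcaveOn ℝ (Ici 0) J
  control : ∀ x ∈ Ω, ∀ v w : E2, ‖v‖ ≤ 1 → ‖w‖ ≤ 1 →
    ‖v - w‖ ^ 2 + ‖g x v - g x w‖ ^ 2 ≤ J (inner ℝ (v - w) (g x v - g x w))
  le_rpow : ∀ s : ℝ, 0 ≤ s → J s ≤ C₀ * s ^ α

/-- Quadratic damping, linear outside the unit ball. -/
def quadraticDrag (_x v : E2) : E2 := if ‖v‖ ≤ 1 then ‖v‖ • v else v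

/-! ### Mixed discretizations -/

/-- Mixed spaces `V_h ⊆ H(div)`, `W_h ⊆ L²` with mesh parameter `h` and order `k`: the divergence
maps `V_h` onto `W_h`, and there is a bounded projection `Π` of `H(div)` onto `V_h` commuting with
the `L²` projection `π` onto `W_h`; `Cproj` (`C_Π`) and `Cscal` (`C_π`) are the constants of
the approximation estimates of `Π` and `π`. (By the boundary condition, the scalars that occur are divergences.) -/
structure MixedPair {Ω : Set E2} (k : ℕ) (h : ℝ) (Vh : Submodule ℝ (Hdiv Ω))
    (Wh : Submodule ℝ (L2s Ω)) [FiniteDimensional ℝ Wh] (P : Hdiv Ω →L[ℝ] Hdiv Ω)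
    (Cproj Cscal : ℝ) : Prop where
  k_pos : 1 ≤ k
  h_pos : 0 < h
  Cproj_pos : 0 < Cproj
  Cscal_pos : 0 < Cscal
  dvg_mem : ∀ v ∈ Vh, dvg v ∈ Wh
  dvg_onto : ∀ w ∈ Wh, ∃ v ∈ Vh, dvg v = w
  proj_mem : ∀ u : Hdiv Ω, P u ∈ Vh
  proj_id : ∀ v ∈ Vh, P v = v
  commute : ∀ u : Hdiv Ω, ∀ w ∈ Wh,
    inner ℝ (dvg (P u)) w = inner ℝ (Wh.starProjection (dvg u)) w
  approx : ∀ u : Hdiv Ω, VMemHk k (fld u) →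
    ‖fld u - fld (P u)‖ ≤ Cproj * h ^ k * vseminormHk k (fld u)
  approx_dvg : ∀ u : Hdiv Ω, MemHk k (dvg u) →
    ‖dvg u - Wh.starProjection (dvg u)‖ ≤ Cscal * h ^ k * seminormHk k (dvg u)

/-- `C_P` is a Poincaré–Friedrichs constant on `V_h`: `‖v‖_{1/H} ≤ C_P ‖∇ · v‖_{1/H}` for all
`v ∈ V_h` that are `(H⁻¹ ·, ·)`-orthogonal to the divergence free elements of `V_h`. -/
def PoincareFriedrichs {Ω : Set E2} (H : E2 → ℝ) (Vh : Submodule ℝ (Hdiv Ω)) (CP : ℝ) : Prop :=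
  ∀ v ∈ Vh, (∀ s ∈ Vh, dvg s = 0 → winner (fun x => 1 / H x) (fld v) (fld s) = 0) →
    Real.sqrt (winner (fun x => 1 / H x) (fld v) (fld v))
      ≤ CP * Real.sqrt (∫ x in Ω, 1 / H x * (dvg v x) ^ 2)

/-! ### Constants -/

/-- `C₁ = (2 + 3 (f^* C_P)² / (2 β H_*)) / H_*`. -/
def const1 (β Hlo fmax CP : ℝ) : ℝ := (2 + 3 * (fmax * CP) ^ 2 / (2 * β * Hlo)) / Hlo

/-- `C₂ = 3 (ε C_P)² H^* / (2 β H_*)`. -/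
def const2 (ε β Hlo Hhi CP : ℝ) : ℝ := 3 * (ε * CP) ^ 2 * Hhi / (2 * β * Hlo)

/-- `C₃ = C₂ + (C₁ + C₂) |Ω| + (H^*/2) (C₁ + C₂)² (2 M + (2 C₀)^{1/α})²`. -/
def const3 (Ω : Set E2) (ε β Hlo Hhi fmax CP M C₀ α : ℝ) : ℝ :=
  const2 ε β Hlo Hhi CP
    + (const1 β Hlo fmax CP + const2 ε β Hlo Hhi CP) * volume.real Ω
    + Hhi / 2 * (const1 β Hlo fmax CP + const2 ε β Hlo Hhi CP) ^ 2
      * (2 * M + (2 * C₀) ^ (1 / α)) ^ 2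

/-- `κ = (C_Π / H_*) |φ_tt|_k + C_Π (f^* / (H_* ε) + M) |φ_t|_k`. -/
def kappa {Ω : Set E2} (k : ℕ) (ε Hlo fmax M Cproj : ℝ) (φ₁ φ₂ : L2v Ω) : ℝ :=
  Cproj / Hlo * vseminormHk k φ₂ + Cproj * (fmax / (Hlo * ε) + M) * vseminormHk k φ₁

end

end Tide

/-!
Let `θ = Π φ - φ_h`, which takes values in `V_h`. Subtracting the two weak equations, and using
`∇ · Π φ = π ∇ · φ` to remove the pressure term, gives the discrete equation for `θ` with a residual
`R` of norm at most `δ = κ h^k ≤ 1` (`error_equation`, `norm_residual_le`). All bounds come from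
testing this equation twice.

* With `v = θ_t`: the Coriolis term vanishes, and `E' = -D + (R, θ_t)`, where `D ≥ 0` is the
  monotonicity pairing of the damping between `Π u` and `u_h`.
* With `v = Q θ`, the part of `θ` that is `(H⁻¹ ·, ·)`-orthogonal to the divergence free fields of
  `V_h` (`exists_divergence_splitting`): the Poincaré–Friedrichs inequality bounds `Q θ` by
  `∇ · θ`, and `X = (H⁻¹ Q θ_t, Q θ)` satisfies
  `X' + E + ½ ‖θ_t‖²_{1/H} ≤ C₁ ‖θ_t‖² + C₂ (‖g(Π u) - g(u_h)‖² + δ²)`.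

The damping controls the right-hand side through a pointwise bound with a free parameter `σ`
(`damping_pointwise`): with `K = 2 M + (2 C₀)^{1/α}`,
`|v - w|² + |g(v) - g(w)|² ≤ (3/2) (σ^α + K σ^{α - 1} (g(v) - g(w)) · (v - w))`.
The factor `3/2` pays for pairs of arguments on different sides of the unit circle. With
`σ = δ^{2/(2 - α)}` one has `(σ^{α - 1} δ)² = σ^α = δ^{2α/(2 - α)}`, so that for
`Λ = (3/2) (C₁ + C₂) K σ^{α - 1}` both tests combine to
`(X + Λ E)' + E ≤ (9/4) C₃ δ^{2α/(2 - α)}` (`dissipation_inequality`). Since `|X| ≤ ν E` with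
`Λ ≥ 9 ν` (`three_mul_le_const`; here `M ≥ 1` enters), `X + Λ E` is equivalent to `E`, and an
absolutely continuous Grönwall argument (`lyapunov_bound`) gives
`E ≤ (4/3) (9/4) C₃ δ^{2α/(2 - α)}` for all times (`error_energy_le`). The case `δ = 0` is a limit.

The remaining estimates are the triangle inequality and the approximation properties of `Π` and
`π`, the latter applied to `-φ`, whose divergence is `η`. That `u(t) ∈ H^k(Ω)²` for every, rather than
almost every, `t` follows from the continuity of `u` in `L²` and weak compactness of balls
(`LinftyHk.vmemHk`). For quadratic damping `(g(v) - g(w)) · (v - w) ≥ ½ |v - w|³` in the unit disc.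
-/

namespace Tide

open Filter Topology

/-! ### Absolutely continuous curves -/

section TimeCalculus

variable {X Y : Type*} [NormedAddCommGroup X] [NormedSpace ℝ X]
  [NormedAddCommGroup Y] [NormedSpace ℝ Y]

lemma IsTimeDeriv.sub_eq_integral {φ φ' : ℝ → X} (h : IsTimeDeriv φ φ') {s t : ℝ}
    (hs : 0 ≤ s) (ht : 0 ≤ t) : φ t - φ s = ∫ r in s..t, φ' r := by
  rw [(h s hs).2, (h t ht).2, ← intervalIntegral.integral_interval_sub_left (h t ht).1 (h s hs).1]
  abel

lemma IsTimeDeriv.absolutelyContinuousOnInterval {φ φ' : ℝ → X} (h : IsTimeDeriv φ φ') {T : ℝ}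
    (hT : 0 ≤ T) : AbsolutelyContinuousOnInterval φ 0 T := by
  have hN := (h T hT).1.norm.absolutelyContinuousOnInterval_intervalIntegral
    (c := 0) left_mem_uIcc
  rw [absolutelyContinuousOnInterval_iff] at hN ⊢
  intro ε hε
  obtain ⟨δ, hδ, H⟩ := hN ε hε
  refine ⟨δ, hδ, fun I hI hlen => lt_of_le_of_lt (Finset.sum_le_sum fun i hi => ?_) (H I hI hlen)⟩
  obtain ⟨h1, h2⟩ := hI.1 i hi
  rw [uIcc_of_le hT] at h1 h2
  rw [dist_eq_norm, h.sub_eq_integral h2.1 h1.1, dist_eq_norm, Real.norm_eq_abs,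
    intervalIntegral.integral_interval_sub_left (h _ h1.1).1.norm (h _ h2.1).1.norm]
  exact intervalIntegral.norm_integral_le_abs_integral_norm

lemma IsTimeDeriv.continuousOn {φ φ' : ℝ → X} (h : IsTimeDeriv φ φ') :
    ContinuousOn φ (Ici 0) := by
  intro t ht
  have ht' : (0 : ℝ) ≤ t := ht
  have h1 := (h.absolutelyContinuousOnInterval (T := t + 1) (by linarith)).continuousOn
  rw [uIcc_of_le (by linarith)] at h1
  refine (h1 t ⟨ht', by linarith⟩).mono_of_mem_nhdsWithin ?_
  refine mem_nhdsWithin.2 ⟨Iio (t + 1), isOpen_Iio, by simp, fun s hs => ⟨hs.2, le_of_lt hs.1⟩⟩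

lemma IsTimeDeriv.ae_hasDerivAt [CompleteSpace X] {φ φ' : ℝ → X} (h : IsTimeDeriv φ φ') :
    ∀ᵐ t ∂(volume.restrict (Ici (0 : ℝ))), HasDerivAt φ (φ' t) t := by
  have h0 : ∀ᵐ t : ℝ, t ≠ 0 := by simp [ae_iff, measure_singleton]
  have h1 : ∀ n : ℕ, ∀ᵐ t : ℝ, t ∈ uIcc (0 : ℝ) n → ∀ c ∈ uIcc (0 : ℝ) n,
      HasDerivAt (fun x => ∫ r in c..x, φ' r) (φ' t) t := fun n =>
    (h n n.cast_nonneg).1.ae_hasDerivAt_integral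
  rw [ae_restrict_iff' measurableSet_Ici]
  filter_upwards [h0, ae_all_iff.2 h1] with t ht0 ht hpos
  have hpos' : 0 < t := lt_of_le_of_ne hpos (Ne.symm ht0)
  obtain ⟨n, hn⟩ := exists_nat_ge t
  have h2 := ht n (by rw [uIcc_of_le n.cast_nonneg]; exact ⟨hpos, hn⟩) 0 left_mem_uIcc
  refine (h2.const_add (φ 0)).congr_of_eventuallyEq ?_
  filter_upwards [lt_mem_nhds hpos'] with s hs
  exact (h s hs.le).2

lemma IsTimeDeriv.clm [CompleteSpace X] [CompleteSpace Y] (L : X →L[ℝ] Y) {φ φ' : ℝ → X}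
    (h : IsTimeDeriv φ φ') : IsTimeDeriv (fun t => L (φ t)) (fun t => L (φ' t)) := by
  intro t ht
  refine ⟨?_, ?_⟩
  · have h1 := (h t ht).1
    rw [intervalIntegrable_iff] at h1 ⊢
    exact L.integrable_comp h1
  · rw [L.intervalIntegral_comp_comm (h t ht).1]
    simp only [(h t ht).2, map_add]

lemma IsTimeDeriv.sub {φ φ' ψ ψ' : ℝ → X} (h : IsTimeDeriv φ φ') (h' : IsTimeDeriv ψ ψ') :
    IsTimeDeriv (fun t => φ t - ψ t) (fun t => φ' t - ψ' t) := by
  intro t ht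
  refine ⟨(h t ht).1.sub (h' t ht).1, ?_⟩
  rw [intervalIntegral.integral_sub (h t ht).1 (h' t ht).1]
  simp only [(h t ht).2, (h' t ht).2]
  abel

/-- Time derivatives in a complete subspace may be computed in the ambient space. -/
lemma IsTimeDeriv.of_coe [CompleteSpace X] {S : Submodule ℝ X} [CompleteSpace S]
    {φ φ' : ℝ → S} (h : IsTimeDeriv (fun t => (φ t : X)) (fun t => (φ' t : X))) :
    IsTimeDeriv φ φ' := by
  intro t ht
  have h1 : IntervalIntegrable φ' volume 0 t := by
    have h2 := (h t ht).1
    rw [intervalIntegrable_iff] at h2 ⊢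
    exact ⟨Topology.IsEmbedding.subtypeVal.aestronglyMeasurable_comp_iff.1 h2.1,
      h2.2.congr' (Eventually.of_forall fun _ => rfl)⟩
  refine ⟨h1, Subtype.ext ?_⟩
  have h3 := S.subtypeL.intervalIntegral_comp_comm h1
  simp only [Submodule.subtypeL_apply] at h3
  rw [Submodule.coe_add, ← h3]
  exact (h t ht).2

lemma absolutelyContinuousOnInterval_inner {Z : Type*} [NormedAddCommGroup Z]
    [InnerProductSpace ℝ Z] {f g : ℝ → Z} {a b : ℝ}
    (hf : AbsolutelyContinuousOnInterval f a b) (hg : AbsolutelyContinuousOnInterval g a b) :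
    AbsolutelyContinuousOnInterval (fun t => inner ℝ (f t) (g t)) a b := by
  obtain ⟨C, hC⟩ := hf.exists_bound
  obtain ⟨D, hD⟩ := hg.exists_bound
  unfold AbsolutelyContinuousOnInterval at hf hg ⊢
  refine squeeze_zero' (Eventually.of_forall fun I => Finset.sum_nonneg fun i _ => dist_nonneg) ?_
    (by simpa using (hf.const_mul D).add (hg.const_mul C))
  rw [eventually_inf_principal]
  refine Eventually.of_forall fun I hI => ?_
  rw [Finset.mul_sum, Finset.mul_sum, ← Finset.sum_add_distrib]
  refine Finset.sum_le_sum fun i hi => ?_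
  obtain ⟨h1, h2⟩ := hI.1 i hi
  set x := (I.2 i).1
  set y := (I.2 i).2
  have key : inner ℝ (f x) (g x) - inner ℝ (f y) (g y)
      = inner ℝ (f x - f y) (g x) + inner ℝ (f y) (g x - g y) := by
    simp only [inner_sub_left, inner_sub_right]; ring
  rw [dist_eq_norm, dist_eq_norm, dist_eq_norm, key]
  refine (norm_add_le _ _).trans (add_le_add ?_ ?_)
  · refine (norm_inner_le_norm _ _).trans ?_
    rw [mul_comm]
    exact mul_le_mul_of_nonneg_right (hD x h1) (norm_nonneg _)
  · exact (norm_inner_le_norm _ _).trans (mul_le_mul_of_nonneg_right (hC y h2) (norm_nonneg _))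

/-- A Lyapunov estimate: if `Y' + e ≤ C` almost everywhere and `Y ≤ m e`, then `Y` never
exceeds `m C`. -/
theorem lyapunov_bound {Y Y' e : ℝ → ℝ} {m C : ℝ} (hm : 0 < m) (hC : 0 ≤ C)
    (hAC : ∀ T : ℝ, 0 ≤ T → AbsolutelyContinuousOnInterval Y 0 T)
    (hderiv : ∀ᵐ t ∂(volume.restrict (Ici (0 : ℝ))), HasDerivAt Y (Y' t) t ∧ Y' t + e t ≤ C)
    (hle : ∀ t, 0 ≤ t → Y t ≤ m * e t) (h0 : Y 0 ≤ 0) {t : ℝ} (ht : 0 ≤ t) : Y t ≤ m * C := by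
  -- `exp (s / m) (Y s - m C)` is absolutely continuous and nonincreasing
  have hexp : AbsolutelyContinuousOnInterval (fun s => Real.exp (s / m)) 0 t := by
    refine ContDiffOn.absolutelyContinuousOnInterval (ContDiff.contDiffOn ?_)
    fun_prop
  have hconst : AbsolutelyContinuousOnInterval (fun _ : ℝ => m * C) 0 t :=
    ContDiffOn.absolutelyContinuousOnInterval contDiffOn_const
  have hZ := hexp.fun_mul ((hAC t ht).fun_sub hconst)
  have h1 := hZ.integral_deriv_eq_sub
  have h2 : ∫ s in (0 : ℝ)..t,
      deriv (fun x => Real.exp (x / m) * (Y x - m * C)) s ≤ 0 := by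
    rw [intervalIntegral.integral_of_le ht]
    refine integral_nonpos_of_ae ?_
    have h3 := ae_restrict_of_ae_restrict_of_subset
      (show Ioc 0 t ⊆ Ici (0 : ℝ) from fun s hs => hs.1.le) hderiv
    filter_upwards [h3, ae_restrict_mem measurableSet_Ioc] with s hs hs'
    have h4 : HasDerivAt (fun x => Real.exp (x / m) * (Y x - m * C))
        (Real.exp (s / m) * (1 / m) * (Y s - m * C) + Real.exp (s / m) * (Y' s)) s :=
      (((hasDerivAt_id s).div_const m).exp).mul (hs.1.sub_const _)
    rw [h4.deriv]
    have h5 := hle s hs'.1.le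
    have h6 : 1 / m * (Y s - m * C) + Y' s ≤ 0 := by
      have h7 : 1 / m * (Y s - m * C) = Y s / m - C := by field_simp
      have h8 : Y s / m ≤ e s := by rw [div_le_iff₀ hm]; linarith
      linarith [hs.2]
    have h9 := mul_nonpos_of_nonneg_of_nonpos (Real.exp_pos (s / m)).le h6
    simp only [Pi.zero_apply]
    linarith
  rw [h1] at h2
  have h3 : Real.exp (0 / m) * (Y 0 - m * C) ≤ 0 :=
    mul_nonpos_of_nonneg_of_nonpos (Real.exp_pos _).le (by nlinarith)
  have h4 : Real.exp (t / m) * (Y t - m * C) ≤ 0 := by linarith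
  have h5 := Real.exp_pos (t / m)
  by_contra! h6
  have := mul_pos h5 (sub_pos.2 h6)
  linarith

end TimeCalculus

/-! ### Operators on square integrable fields -/

lemma coeFn_sub_ae {Ω : Set E2} (u v : L2v Ω) :
    ∀ᵐ x ∂(volume.restrict Ω), (u - v) x = u x - v x := Lp.coeFn_sub u v

lemma exists_mul_operator {μ : Measure E2} {a : E2 → ℝ} {c : ℝ} (ha : AEMeasurable a μ)
    (hb : ∀ᵐ x ∂μ, |a x| ≤ c) :
    ∃ T : Lp E2 2 μ →L[ℝ] Lp E2 2 μ,
      (∀ u, T u =ᵐ[μ] fun x => a x • u x) ∧ ∀ u, ‖T u‖ ≤ c * ‖u‖ := by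
  have hm : ∀ u : Lp E2 2 μ, MemLp (fun x => a x • u x) 2 μ := fun u => by
    refine (Lp.memLp u).of_le_mul (c := c)
      (ha.aestronglyMeasurable.smul (Lp.aestronglyMeasurable u)) ?_
    filter_upwards [hb] with x hx
    rw [norm_smul]
    exact mul_le_mul_of_nonneg_right hx (norm_nonneg _)
  have hn : ∀ u : Lp E2 2 μ, ‖(hm u).toLp‖ ≤ c * ‖u‖ := fun u => by
    refine Lp.norm_le_mul_norm_of_ae_le_mul ?_
    filter_upwards [hb, (hm u).coeFn_toLp] with x hx hx'
    rw [hx', norm_smul]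
    exact mul_le_mul_of_nonneg_right hx (norm_nonneg _)
  refine ⟨LinearMap.mkContinuous
    { toFun := fun u => (hm u).toLp
      map_add' := fun u v => ?_
      map_smul' := fun r u => ?_ } c hn, fun u => (hm u).coeFn_toLp, hn⟩
  · refine Lp.ext ?_
    filter_upwards [(hm (u + v)).coeFn_toLp, (hm u).coeFn_toLp, (hm v).coeFn_toLp,
      Lp.coeFn_add u v, Lp.coeFn_add ((hm u).toLp) ((hm v).toLp)] with x h1 h2 h3 h4 h5
    rw [h1, h5, Pi.add_apply, h2, h3, h4, Pi.add_apply, smul_add]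
  · refine Lp.ext ?_
    filter_upwards [(hm (r • u)).coeFn_toLp, (hm u).coeFn_toLp,
      Lp.coeFn_smul r u, Lp.coeFn_smul r ((hm u).toLp)] with x h1 h2 h4 h5
    rw [h1, RingHom.id_apply, h5, Pi.smul_apply, h2, h4, Pi.smul_apply, smul_comm]

/-- The rotation `v ↦ v^⊥` as a linear map. -/
noncomputable def rotCLM : E2 →L[ℝ] E2 :=
  LinearMap.toContinuousLinearMap
    { toFun := rot
      map_add' := fun u v => by
        ext i; fin_cases i <;> simp [rot, add_comm]
      map_smul' := fun r u => by
        ext i; fin_cases i <;> simp [rot] }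

lemma rotCLM_apply (v : E2) : rotCLM v = rot v := rfl

lemma norm_rot (v : E2) : ‖rot v‖ = ‖v‖ := by
  simp [EuclideanSpace.norm_eq, rot, Fin.sum_univ_two, add_comm]

lemma inner_rot_self (v : E2) : inner ℝ (rot v) v = 0 := by
  simp [PiLp.inner_apply, rot, Fin.sum_univ_two]; ring

/-- The weight `1 / H` and the Coriolis term in terms of bounded operators: `T` is multiplication by
`H ^ (-1/2)`, and `S` is `v ↦ (f / ε) v^⊥`. -/
theorem exists_weight_operators {Ω : Set E2} {H f : E2 → ℝ} {Hlo Hhi fmax ε : ℝ} (hε : 0 < ε)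
    (hc : CoeffBounds Ω H f Hlo Hhi fmax) :
    ∃ T S : L2v Ω →L[ℝ] L2v Ω,
      (∀ u v, winner (fun x => 1 / H x) u v = inner ℝ (T u) (T v)) ∧
      (∀ u v, inner ℝ (T u) v = inner ℝ u (T v)) ∧
      (∀ u, ‖T u‖ ^ 2 ≤ 1 / Hlo * ‖u‖ ^ 2) ∧
      (∀ u, ‖u‖ ^ 2 ≤ Hhi * ‖T u‖ ^ 2) ∧
      (∀ u v, ∫ x in Ω, f x / (H x * ε) * inner ℝ (rot (u x)) (v x) = inner ℝ (S (T u)) (T v)) ∧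
      (∀ u, ‖S u‖ ≤ fmax / ε * ‖u‖) ∧
      (∀ u, inner ℝ (S u) u = 0) := by
  have hlo := hc.lo_pos
  have hhi : 0 < Hhi := hlo.trans_le hc.lo_le_hi
  have hsq : ∀ {y : ℝ}, Hlo ≤ y → √(1 / y) * √(1 / y) = 1 / y := fun {y} hy =>
    Real.mul_self_sqrt (by have := hlo.trans_le hy; positivity)
  obtain ⟨T, hT, hTn⟩ := exists_mul_operator (μ := volume.restrict Ω)
    (a := fun x => √(1 / H x)) (c := √(1 / Hlo))
    (Real.continuous_sqrt.measurable.comp_aemeasurable (hc.meas_H.const_div 1))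
    (by
      filter_upwards [hc.H_mem] with x hx
      rw [abs_of_nonneg (Real.sqrt_nonneg _)]
      exact Real.sqrt_le_sqrt (one_div_le_one_div_of_le hlo hx.1))
  obtain ⟨S₀, hS₀, hS₀n⟩ := exists_mul_operator (μ := volume.restrict Ω)
    (a := fun x => f x / ε) (c := fmax / ε) (hc.meas_f.div_const ε)
    (by
      filter_upwards [hc.f_le] with x hx
      rw [abs_div, abs_of_pos hε]
      exact div_le_div_of_nonneg_right hx hε.le)
  have hR : ∀ u : L2v Ω, ∀ᵐ x ∂(volume.restrict Ω),
      (rotCLM.compLpL 2 (volume.restrict Ω) u) x = rot (u x) := fun u =>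
    ContinuousLinearMap.coeFn_compLpL rotCLM u
  refine ⟨T, S₀.comp (rotCLM.compLpL 2 (volume.restrict Ω)), fun u v => ?_, fun u v => ?_,
    fun u => ?_, fun u => ?_, fun u v => ?_, fun u => ?_, fun u => ?_⟩
  · rw [L2.inner_def]
    refine integral_congr_ae ?_
    filter_upwards [hT u, hT v, hc.H_mem] with x h1 h2 h3
    rw [h1, h2, real_inner_smul_left, real_inner_smul_right, ← mul_assoc, hsq h3.1]
  · rw [L2.inner_def, L2.inner_def]
    refine integral_congr_ae ?_
    filter_upwards [hT u, hT v] with x h1 h2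
    rw [h1, h2, real_inner_smul_left, real_inner_smul_right]
  · have h1 := pow_le_pow_left₀ (norm_nonneg _) (hTn u) 2
    rwa [mul_pow, Real.sq_sqrt (by positivity)] at h1
  · have h1 : ‖u‖ ≤ √Hhi * ‖T u‖ := by
      refine Lp.norm_le_mul_norm_of_ae_le_mul ?_
      filter_upwards [hT u, hc.H_mem] with x h1 h2
      rw [h1, norm_smul, Real.norm_eq_abs, abs_of_nonneg (Real.sqrt_nonneg _), ← mul_assoc,
        ← Real.sqrt_mul hhi.le]
      have h3 : 1 ≤ √(Hhi * (1 / H x)) := by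
        rw [Real.one_le_sqrt, mul_one_div, one_le_div (hlo.trans_le h2.1)]
        exact h2.2
      nlinarith [norm_nonneg (u x)]
    have h2 := pow_le_pow_left₀ (norm_nonneg _) h1 2
    rwa [mul_pow, Real.sq_sqrt hhi.le] at h2
  · rw [L2.inner_def]
    refine integral_congr_ae ?_
    filter_upwards [hT u, hT v, hS₀ (rotCLM.compLpL 2 (volume.restrict Ω) (T u)), hR (T u),
      hc.H_mem] with x h1 h2 h3 h4 h5
    rw [ContinuousLinearMap.comp_apply, h3, h4, h1, h2, ← rotCLM_apply, ← rotCLM_apply, map_smul]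
    simp only [real_inner_smul_left, real_inner_smul_right]
    have h6 := hsq h5.1
    have h7 := hlo.trans_le h5.1
    have h8 : f x / (H x * ε) = f x / ε * (1 / H x) := by field_simp
    rw [h8]
    linear_combination (-(f x / ε * inner ℝ (rotCLM (u x)) (v x))) * h6
  · rw [ContinuousLinearMap.comp_apply]
    refine (hS₀n _).trans (mul_le_mul_of_nonneg_left ?_ (div_nonneg hc.fmax_nonneg hε.le))
    refine Lp.norm_le_norm_of_ae_le ?_
    filter_upwards [hR u] with x h1
    rw [h1, norm_rot]
  · rw [L2.inner_def]
    refine integral_eq_zero_of_ae ?_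
    filter_upwards [hS₀ (rotCLM.compLpL 2 (volume.restrict Ω) u), hR u] with x h1 h2
    rw [ContinuousLinearMap.comp_apply, h1, h2, real_inner_smul_left, inner_rot_self, mul_zero]
    rfl

lemma integral_weight_sq_le {Ω : Set E2} {H f : E2 → ℝ} {Hlo Hhi fmax : ℝ}
    (hc : CoeffBounds Ω H f Hlo Hhi fmax) (q : L2s Ω) :
    ∫ x in Ω, 1 / H x * (q x) ^ 2 ≤ 1 / Hlo * ‖q‖ ^ 2 := by
  have h1 : ‖q‖ ^ 2 = ∫ x in Ω, (q x) ^ 2 := by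
    rw [← real_inner_self_eq_norm_sq, L2.inner_def]
    refine integral_congr_ae (Eventually.of_forall fun x => ?_)
    simp [sq]
  rw [h1, ← integral_const_mul]
  have hint : Integrable (fun x => (q x) ^ 2) (volume.restrict Ω) := (Lp.memLp q).integrable_sq
  refine integral_mono_of_nonneg ?_ (hint.const_mul _) ?_
  · filter_upwards [hc.H_mem] with x hx
    have := hc.lo_pos.trans_le hx.1
    simp only [Pi.zero_apply]
    positivity
  · filter_upwards [hc.H_mem] with x hx
    exact mul_le_mul_of_nonneg_right (one_div_le_one_div_of_le hc.lo_pos hx.1) (sq_nonneg _)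

/-- The superposition operator `u ↦ g (·, u(·))` on `L²(Ω)`. -/
theorem exists_damping_operator {Ω : Set E2} (hΩ : IsOpen Ω) (hΩb : Bornology.IsBounded Ω)
    {g : E2 → E2 → E2} {M : ℝ} (hg : Damping Ω g M) :
    ∃ G : L2v Ω → L2v Ω, ∀ u, ∀ᵐ x ∂(volume.restrict Ω), G u x = g x (u x) := by
  have : IsFiniteMeasure (volume.restrict Ω) := ⟨by
    rw [Measure.restrict_apply_univ]; exact hΩb.measure_lt_top⟩
  have hcl : IsCompact (closure Ω) := hΩb.isCompact_closure
  obtain ⟨K, hK⟩ : ∃ K, ∀ x ∈ closure Ω, ‖g x 0‖ ≤ K := by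
    refine hcl.exists_bound_of_continuousOn (f := fun x => g x 0) ?_
    exact hg.cont.comp (Continuous.continuousOn (f := fun x : E2 => (x, (0 : E2))) (by fun_prop))
      (fun x hx => ⟨hx, mem_univ _⟩)
  classical
  have hms : MeasurableSet (closure Ω ×ˢ (univ : Set E2)) :=
    isClosed_closure.measurableSet.prod MeasurableSet.univ
  have hmeas : Measurable ((closure Ω ×ˢ (univ : Set E2)).piecewise
      (fun p : E2 × E2 => g p.1 p.2) 0) :=
    hg.cont.measurable_piecewise continuousOn_const hms
  have hae : ∀ u : L2v Ω, AEStronglyMeasurable (fun x => g x (u x)) (volume.restrict Ω) := by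
    intro u
    have h1 : Measurable fun x : E2 => (x, u x) :=
      measurable_id.prodMk (Lp.stronglyMeasurable u).measurable
    refine (hmeas.comp h1).aestronglyMeasurable.congr ?_
    filter_upwards [ae_restrict_mem hΩ.measurableSet] with x hx
    rw [Function.comp_apply, piecewise_eq_of_mem]
    exact ⟨subset_closure hx, mem_univ _⟩
  have hm : ∀ u : L2v Ω, MemLp (fun x => g x (u x)) 2 (volume.restrict Ω) := by
    intro u
    have h0 : MemLp (fun x => M * ‖u x‖ + K) 2 (volume.restrict Ω) :=
      ((Lp.memLp u).norm.const_mul M).add (memLp_const K)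
    refine h0.mono' (hae u) ?_
    filter_upwards [ae_restrict_mem hΩ.measurableSet] with x hx
    have h1 := hg.lipschitz x hx (u x) 0
    have h2 := hK x (subset_closure hx)
    rw [sub_zero] at h1
    calc ‖g x (u x)‖ = ‖(g x (u x) - g x 0) + g x 0‖ := by rw [sub_add_cancel]
      _ ≤ _ := (norm_add_le _ _).trans (add_le_add h1 h2)
  exact ⟨fun u => (hm u).toLp, fun u => (hm u).coeFn_toLp⟩

lemma damping_operator_inner {Ω : Set E2} {g : E2 → E2 → E2} {G : L2v Ω → L2v Ω}
    (hG : ∀ u, ∀ᵐ x ∂(volume.restrict Ω), G u x = g x (u x)) (u v : L2v Ω) :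
    ∫ x in Ω, inner ℝ (g x (u x)) (v x) = inner ℝ (G u) v := by
  rw [L2.inner_def]
  refine integral_congr_ae ?_
  filter_upwards [hG u] with x hx
  rw [hx]

lemma damping_operator_lipschitz {Ω : Set E2} (hΩ : IsOpen Ω) {g : E2 → E2 → E2} {M : ℝ}
    (hg : Damping Ω g M) {G : L2v Ω → L2v Ω}
    (hG : ∀ u, ∀ᵐ x ∂(volume.restrict Ω), G u x = g x (u x)) (u v : L2v Ω) :
    ‖G u - G v‖ ≤ M * ‖u - v‖ := by
  refine Lp.norm_le_mul_norm_of_ae_le_mul ?_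
  filter_upwards [hG u, hG v, coeFn_sub_ae (G u) (G v), coeFn_sub_ae u v,
    ae_restrict_mem hΩ.measurableSet] with x h1 h2 h3 h4 hx
  rw [h3, h4, h1, h2]
  exact hg.lipschitz x hx _ _

/-- A pointwise bound by `A + N (g(v) - g(w)) · (v - w)` integrates to a bound in `L²(Ω)`. -/
lemma damping_operator_control {Ω : Set E2} (hΩ : IsOpen Ω) (hΩb : Bornology.IsBounded Ω)
    {g : E2 → E2 → E2} {G : L2v Ω → L2v Ω}
    (hG : ∀ u, ∀ᵐ x ∂(volume.restrict Ω), G u x = g x (u x)) {A N : ℝ}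
    (hpt : ∀ x ∈ Ω, ∀ v w : E2, ‖v - w‖ ^ 2 + ‖g x v - g x w‖ ^ 2
      ≤ A + N * inner ℝ (g x v - g x w) (v - w)) (u v : L2v Ω) :
    ‖u - v‖ ^ 2 + ‖G u - G v‖ ^ 2
      ≤ A * volume.real Ω + N * inner ℝ (G u - G v) (u - v) := by
  have hfin : IsFiniteMeasure (volume.restrict Ω) := ⟨by
    rw [Measure.restrict_apply_univ]; exact hΩb.measure_lt_top⟩
  have h1 : A * volume.real Ω = ∫ _x in Ω, A := by
    rw [setIntegral_const, smul_eq_mul, mul_comm]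
  rw [h1, ← real_inner_self_eq_norm_sq, ← real_inner_self_eq_norm_sq, L2.inner_def, L2.inner_def,
    L2.inner_def, ← integral_add (L2.integrable_inner _ _) (L2.integrable_inner _ _),
    ← integral_const_mul,
    ← integral_add (integrable_const _) ((L2.integrable_inner _ _).const_mul _)]
  refine integral_mono_ae ((L2.integrable_inner _ _).add (L2.integrable_inner _ _))
    ((integrable_const _).add ((L2.integrable_inner _ _).const_mul _)) ?_
  filter_upwards [hG u, hG v, coeFn_sub_ae (G u) (G v), coeFn_sub_ae u v,
    ae_restrict_mem hΩ.measurableSet] with x h1 h2 h3 h4 hx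
  have h5 := hpt x hx (u x) (v x)
  rw [h3, h4, h1, h2, real_inner_self_eq_norm_sq, real_inner_self_eq_norm_sq]
  exact h5

/-! ### Pointwise estimates for the damping -/

lemma Damping.inner_nonneg {Ω : Set E2} {g : E2 → E2 → E2} {M : ℝ} (hg : Damping Ω g M)
    {x : E2} (hx : x ∈ Ω) (v w : E2) : 0 ≤ inner ℝ (g x v - g x w) (v - w) := by
  by_cases h : v = w
  · simp [h]
  · exact (hg.mono x hx v w h).le

/-- The two growth conditions force `M ≥ 1`. -/
lemma Damping.one_le {Ω : Set E2} {g : E2 → E2 → E2} {M : ℝ} (hg : Damping Ω g M)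
    (hne : Ω.Nonempty) : 1 ≤ M := by
  obtain ⟨x, hx⟩ := hne
  set e : E2 := EuclideanSpace.single 0 (1 : ℝ) with he
  have hen : ‖e‖ = 1 := by simp [he]
  have h2e : ‖(2 : ℝ) • e‖ = 2 := by rw [norm_smul, hen]; norm_num
  have hd : ‖(2 : ℝ) • e - e‖ = 1 := by rw [two_smul, add_sub_cancel_right, hen]
  obtain ⟨h1, h2⟩ := hg.growth x hx ((2 : ℝ) • e) e (by rw [h2e]; norm_num) hen.ge
  have h3 := real_inner_le_norm (g x ((2 : ℝ) • e) - g x e) ((2 : ℝ) • e - e)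
  rw [hd, mul_one] at h3
  rw [hd] at h1
  have hM := hg.M_pos
  set s := inner ℝ (g x ((2 : ℝ) • e) - g x e) ((2 : ℝ) • e - e)
  set a := ‖g x ((2 : ℝ) • e) - g x e‖
  by_contra! hM1
  have hs : 0 < s := by
    by_contra! h
    nlinarith
  have hMs : M * s < s := mul_lt_of_lt_one_left hs hM1
  nlinarith

lemma exists_segment_norm_eq_one {v w : E2} (hv : 1 ≤ ‖v‖) (hw : ‖w‖ ≤ 1) :
    ∃ b ∈ Icc (0 : ℝ) 1, ‖w + b • (v - w)‖ = 1 := by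
  have hc : ContinuousOn (fun b : ℝ => ‖w + b • (v - w)‖) (Icc 0 1) := by fun_prop
  have h := intermediate_value_Icc zero_le_one hc
  exact h ⟨by simpa using hw, by simpa using hv⟩

/-- Splitting a segment does not increase the sum of the monotonicity pairings. -/
lemma Damping.inner_add_inner_le {Ω : Set E2} {g : E2 → E2 → E2} {M : ℝ} (hg : Damping Ω g M)
    {x : E2} (hx : x ∈ Ω) (v w : E2) {b : ℝ} (hb : b ∈ Icc (0 : ℝ) 1) {z : E2}
    (hz : z = w + b • (v - w)) :
    inner ℝ (g x v - g x z) (v - z) + inner ℝ (g x z - g x w) (z - w)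
      ≤ inner ℝ (g x v - g x w) (v - w) := by
  have e1 : v - z = (1 - b) • (v - w) := by rw [hz]; module
  have e2 : z - w = b • (v - w) := by rw [hz]; module
  have h1 : 0 ≤ inner ℝ (g x v - g x z) (v - w) := by
    have h := hg.inner_nonneg hx v z
    rcases eq_or_lt_of_le hb.2 with hb1 | hb1
    · have : z = v := by rw [hz, hb1]; module
      simp [this]
    · rw [e1, real_inner_smul_right] at h
      exact nonneg_of_mul_nonneg_right h (by linarith)
  have h2 : 0 ≤ inner ℝ (g x z - g x w) (v - w) := by
    have h := hg.inner_nonneg hx z w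
    rcases eq_or_lt_of_le hb.1 with hb1 | hb1
    · have : z = w := by rw [hz, ← hb1]; module
      simp [this]
    · rw [e2, real_inner_smul_right] at h
      exact nonneg_of_mul_nonneg_right h hb1
  have h3 : inner ℝ (g x v - g x w) (v - w)
      = inner ℝ (g x v - g x z) (v - w) + inner ℝ (g x z - g x w) (v - w) := by
    rw [← inner_add_left]; congr 1; abel
  rw [h3, e1, e2, real_inner_smul_right, real_inner_smul_right]
  nlinarith [hb.1, hb.2]

lemma norm_add_sq_le_weighted {V : Type*} [SeminormedAddCommGroup V] (a b : V) :
    ‖a + b‖ ^ 2 ≤ 3 / 2 * ‖a‖ ^ 2 + 3 * ‖b‖ ^ 2 := by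
  have h := pow_le_pow_left₀ (norm_nonneg _) (norm_add_le a b) 2
  nlinarith [sq_nonneg (‖a‖ - 2 * ‖b‖)]

/-- Young's inequality for the sublinear term, with a free parameter `σ`. -/
lemma two_mul_rpow_le {C₀ α σ s : ℝ} (hC : 0 < C₀) (hα : 0 < α) (hα1 : α < 1) (hσ : 0 < σ)
    (hs : 0 ≤ s) :
    2 * C₀ * s ^ α ≤ σ ^ α + (2 * C₀) ^ (1 / α) * σ ^ (α - 1) * s := by
  have hc : 0 < 2 * C₀ := by linarith
  have hx : 0 ≤ (2 * C₀) ^ (1 / α) * σ ^ (α - 1) * s := by positivity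
  have hy : 0 ≤ σ ^ α := by positivity
  have h := Real.geom_mean_le_arith_mean2_weighted hα.le (by linarith : 0 ≤ 1 - α) hx hy
    (by ring)
  have h1 : ((2 * C₀) ^ (1 / α) * σ ^ (α - 1) * s) ^ α * (σ ^ α) ^ (1 - α)
      = 2 * C₀ * s ^ α := by
    rw [Real.mul_rpow (by positivity) hs, Real.mul_rpow (by positivity) (by positivity),
      ← Real.rpow_mul hc.le, ← Real.rpow_mul hσ.le, ← Real.rpow_mul hσ.le,
      one_div_mul_cancel hα.ne', Real.rpow_one]
    have h2 : σ ^ ((α - 1) * α) * σ ^ (α * (1 - α)) = 1 := by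
      rw [← Real.rpow_add hσ, show (α - 1) * α + α * (1 - α) = 0 by ring, Real.rpow_zero]
    linear_combination (2 * C₀ * s ^ α) * h2
  rw [h1] at h
  nlinarith

/-- The damping controls differences of arguments and values, up to the error `σ ^ α`. If `v` lies
outside and `w` inside the unit disc, the segment from `v` to `w` is split where it crosses the
unit circle. -/
theorem damping_pointwise {Ω : Set E2} {g : E2 → E2 → E2} {M : ℝ} (hg : Damping Ω g M)
    {J : ℝ → ℝ} {C₀ α : ℝ} (hJ : DampingProfile Ω g J C₀ α) {σ : ℝ} (hσ : 0 < σ) (hσ1 : σ ≤ 1)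
    {x : E2} (hx : x ∈ Ω) (v w : E2) :
    ‖v - w‖ ^ 2 + ‖g x v - g x w‖ ^ 2 ≤ 3 / 2 * σ ^ α
      + 3 / 2 * (2 * M + (2 * C₀) ^ (1 / α)) * σ ^ (α - 1)
        * inner ℝ (g x v - g x w) (v - w) := by
  have hC := hJ.C₀_pos
  have hM := hg.M_pos
  have hA : 0 < σ ^ α := by positivity
  have hc : 0 < (2 * C₀) ^ (1 / α) := by positivity
  have hL : 1 ≤ σ ^ (α - 1) :=
    Real.one_le_rpow_of_pos_of_le_one_of_nonpos hσ hσ1 (by linarith [hJ.α_lt_one])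
  set c := (2 * C₀) ^ (1 / α)
  set L := σ ^ (α - 1)
  set A := σ ^ α
  have hout : ∀ a b : E2, 1 ≤ ‖a‖ → 1 ≤ ‖b‖ → ‖a - b‖ ^ 2 + ‖g x a - g x b‖ ^ 2
      ≤ 2 * M * L * inner ℝ (g x a - g x b) (a - b) := by
    intro a b ha hb
    obtain ⟨h1, h2⟩ := hg.growth x hx a b ha hb
    have h3 : 0 ≤ M * inner ℝ (g x a - g x b) (a - b) :=
      mul_nonneg hM.le (hg.inner_nonneg hx a b)
    nlinarith
  have hin : ∀ a b : E2, ‖a‖ ≤ 1 → ‖b‖ ≤ 1 → 2 * (‖a - b‖ ^ 2 + ‖g x a - g x b‖ ^ 2)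
      ≤ A + c * L * inner ℝ (g x a - g x b) (a - b) := by
    intro a b ha hb
    have h1 := hJ.control x hx a b ha hb
    rw [real_inner_comm] at h1
    have h2 := hg.inner_nonneg hx a b
    have h3 := hJ.le_rpow _ h2
    have h4 := two_mul_rpow_le hC hJ.α_pos hJ.α_lt_one hσ h2
    linarith
  have hmix : ∀ a b : E2, 1 ≤ ‖a‖ → ‖b‖ ≤ 1 → ‖a - b‖ ^ 2 + ‖g x a - g x b‖ ^ 2
      ≤ 3 / 2 * A + 3 / 2 * (2 * M + c) * L * inner ℝ (g x a - g x b) (a - b) := by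
    intro a b ha hb
    obtain ⟨r, hr, hz⟩ := exists_segment_norm_eq_one ha hb
    obtain ⟨z, hzd⟩ : ∃ z, z = b + r • (a - b) := ⟨_, rfl⟩
    rw [← hzd] at hz
    have h1 := hg.inner_add_inner_le hx a b hr hzd
    have h2 := hout a z ha hz.ge
    have h3 := hin z b hz.le hb
    have h4 := hg.inner_nonneg hx a z
    have h5 := hg.inner_nonneg hx z b
    have h6 := norm_add_sq_le_weighted (a - z) (z - b)
    have h7 := norm_add_sq_le_weighted (g x a - g x z) (g x z - g x b)
    rw [sub_add_sub_cancel] at h6 h7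
    have h8 : 0 ≤ c * L * inner ℝ (g x a - g x z) (a - z) := by positivity
    have h9 : 0 ≤ M * L * inner ℝ (g x z - g x b) (z - b) := by positivity
    have h10 : 0 ≤ (2 * M + c) * L := by positivity
    have h11 := mul_le_mul_of_nonneg_left h1 h10
    linarith
  rcases le_total 1 ‖v‖ with hv | hv <;> rcases le_total 1 ‖w‖ with hw | hw
  · have h1 := hout v w hv hw
    have h2 := hg.inner_nonneg hx v w
    have h3 : 0 ≤ c * L * inner ℝ (g x v - g x w) (v - w) := by positivity
    have h4 : 0 ≤ M * L * inner ℝ (g x v - g x w) (v - w) := by positivity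
    linarith
  · exact hmix v w hv hw
  · have h := hmix w v hw hv
    rw [norm_sub_rev w v, norm_sub_rev (g x w), ← neg_sub v w, ← neg_sub (g x v) (g x w),
      inner_neg_neg] at h
    exact h
  · have h1 := hin v w hv hw
    have h2 := hg.inner_nonneg hx v w
    have h3 : 0 ≤ c * L * inner ℝ (g x v - g x w) (v - w) := by positivity
    have h4 : 0 ≤ M * L * inner ℝ (g x v - g x w) (v - w) := by positivity
    nlinarith [sq_nonneg ‖v - w‖, sq_nonneg ‖g x v - g x w‖]

/-! ### Quadratic damping -/

lemma quadraticDrag_eq (x v : E2) : quadraticDrag x v = min ‖v‖ 1 • v := by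
  unfold quadraticDrag
  split_ifs with h
  · rw [min_eq_left h]
  · rw [min_eq_right (not_le.1 h).le, one_smul]

lemma quadraticDrag_inner_ge (x v w : E2) :
    1 / 2 * (min ‖v‖ 1 + min ‖w‖ 1) * ‖v - w‖ ^ 2
      ≤ inner ℝ (quadraticDrag x v - quadraticDrag x w) (v - w) := by
  rw [quadraticDrag_eq, quadraticDrag_eq]
  set a := min ‖v‖ 1
  set b := min ‖w‖ 1
  have h1 : inner ℝ (a • v - b • w) (v - w)
      = 1 / 2 * (a + b) * ‖v - w‖ ^ 2 + 1 / 2 * ((a - b) * (‖v‖ ^ 2 - ‖w‖ ^ 2)) := by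
    rw [norm_sub_sq_real]
    simp only [inner_sub_left, inner_sub_right, real_inner_smul_left,
      real_inner_self_eq_norm_sq, real_inner_comm v w]
    ring
  have h2 : 0 ≤ (a - b) * (‖v‖ ^ 2 - ‖w‖ ^ 2) := by
    rcases le_total ‖v‖ ‖w‖ with h | h
    · refine mul_nonneg_of_nonpos_of_nonpos (sub_nonpos.2 (min_le_min_right 1 h)) ?_
      nlinarith [norm_nonneg v]
    · refine mul_nonneg (sub_nonneg.2 (min_le_min_right 1 h)) ?_
      nlinarith [norm_nonneg w]
  linarith

lemma quadraticDrag_lipschitz (x v w : E2) :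
    ‖quadraticDrag x v - quadraticDrag x w‖ ≤ 2 * ‖v - w‖ := by
  have key : ∀ a b : E2, ‖b‖ ≤ 1 →
      ‖quadraticDrag x a - quadraticDrag x b‖ ≤ 2 * ‖a - b‖ := by
    intro a b hb
    rw [quadraticDrag_eq, quadraticDrag_eq]
    have h1 : min ‖a‖ 1 • a - min ‖b‖ 1 • b
        = min ‖a‖ 1 • (a - b) + (min ‖a‖ 1 - min ‖b‖ 1) • b := by module
    have h2 : ‖min ‖a‖ 1 • (a - b)‖ ≤ ‖a - b‖ := by
      rw [norm_smul, Real.norm_eq_abs, abs_of_nonneg (le_min (norm_nonneg _) zero_le_one)]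
      exact mul_le_of_le_one_left (norm_nonneg _) (min_le_right _ _)
    have h3 : ‖(min ‖a‖ 1 - min ‖b‖ 1) • b‖ ≤ ‖a - b‖ := by
      rw [norm_smul, Real.norm_eq_abs]
      have h4 : |min ‖a‖ 1 - min ‖b‖ 1| ≤ ‖a - b‖ :=
        (abs_min_sub_min_le_max _ _ _ _).trans (by
          rw [sub_self, abs_zero, max_eq_left (abs_nonneg _)]
          exact abs_norm_sub_norm_le a b)
      calc _ ≤ ‖a - b‖ * 1 := mul_le_mul h4 hb (norm_nonneg _) (norm_nonneg _)
        _ = _ := mul_one _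
    rw [h1]
    linarith [norm_add_le (min ‖a‖ 1 • (a - b)) ((min ‖a‖ 1 - min ‖b‖ 1) • b)]
  rcases le_total ‖w‖ 1 with hw | hw
  · exact key v w hw
  rcases le_total ‖v‖ 1 with hv | hv
  · rw [norm_sub_rev, norm_sub_rev v w]
    exact key w v hv
  · rw [quadraticDrag_eq, quadraticDrag_eq, min_eq_right hv, min_eq_right hw, one_smul, one_smul]
    linarith [norm_nonneg (v - w)]

lemma quadraticDrag_damping (Ω : Set E2) : Damping Ω quadraticDrag 2 where
  M_pos := two_pos
  cont := by
    have h : (fun p : E2 × E2 => quadraticDrag p.1 p.2) = fun p => min ‖p.2‖ 1 • p.2 :=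
      funext fun p => quadraticDrag_eq _ _
    rw [h]
    fun_prop
  mono := by
    intro x _ v w hvw
    refine lt_of_lt_of_le ?_ (quadraticDrag_inner_ge x v w)
    have h1 : 0 < ‖v - w‖ := norm_pos_iff.2 (sub_ne_zero.2 hvw)
    have h2 : 0 < min ‖v‖ 1 + min ‖w‖ 1 := by
      by_cases hv : v = 0
      · have hw : 0 < ‖w‖ := norm_pos_iff.2 fun h => hvw (hv.trans h.symm)
        have := lt_min hw one_pos
        have := le_min (norm_nonneg v) zero_le_one
        linarith
      · have := lt_min (norm_pos_iff.2 hv) one_pos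
        have := le_min (norm_nonneg w) zero_le_one
        linarith
    positivity
  growth := by
    intro x _ v w hv hw
    rw [quadraticDrag_eq, quadraticDrag_eq, min_eq_right hv, min_eq_right hw, one_smul, one_smul,
      real_inner_self_eq_norm_sq]
    constructor <;> nlinarith [sq_nonneg ‖v - w‖]
  lipschitz := fun x _ v w => quadraticDrag_lipschitz x v w

/-- In the unit disc `(g(v) - g(w)) · (v - w) ≥ |v - w|³ / 2`, whence the exponent `2 / 3`. -/
lemma quadraticDrag_profile (Ω : Set E2) :
    DampingProfile Ω quadraticDrag (fun s => 5 * 2 ^ (2 / 3 : ℝ) * s ^ (2 / 3 : ℝ))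
      (5 * 2 ^ (2 / 3 : ℝ)) (2 / 3) where
  C₀_pos := by positivity
  α_pos := by norm_num
  α_lt_one := by norm_num
  zero := by simp [Real.zero_rpow (by norm_num : (2 / 3 : ℝ) ≠ 0)]
  mono := fun a ha b _ hab =>
    mul_le_mul_of_nonneg_left (Real.rpow_le_rpow ha hab (by norm_num)) (by positivity)
  concave := (Real.concaveOn_rpow (by norm_num) (by norm_num)).smul (by positivity)
  control := by
    intro x _ v w hv hw
    have h1 := quadraticDrag_inner_ge x v w
    have h2 := quadraticDrag_lipschitz x v w
    rw [real_inner_comm]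
    set s := inner ℝ (quadraticDrag x v - quadraticDrag x w) (v - w)
    rw [min_eq_left hv, min_eq_left hw] at h1
    have h3 := norm_sub_le v w
    have hd := norm_nonneg (v - w)
    have h4 : ‖v - w‖ ^ 3 ≤ 2 * s := by
      nlinarith [mul_le_mul_of_nonneg_right h3 (sq_nonneg ‖v - w‖)]
    have hs : 0 ≤ s := by nlinarith [pow_nonneg hd 3]
    have h5 : ‖v - w‖ ^ 2 ≤ 2 ^ (2 / 3 : ℝ) * s ^ (2 / 3 : ℝ) := by
      rw [← Real.mul_rpow (by norm_num) hs]
      calc ‖v - w‖ ^ 2 = (‖v - w‖ ^ 3) ^ (2 / 3 : ℝ) := by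
            rw [← Real.rpow_natCast, ← Real.rpow_natCast, ← Real.rpow_mul hd]
            norm_num
        _ ≤ _ := Real.rpow_le_rpow (by positivity) h4 (by norm_num)
    have h6 := pow_le_pow_left₀ (norm_nonneg _) h2 2
    nlinarith
  le_rpow := fun s _ => le_rfl

/-! ### The energy method -/

/-- If `τ` is injective on the finite-dimensional subspace `W`, every vector splits into an element
of `W` and a part `Q v` whose image under `τ` is orthogonal to `τ W`. -/
lemma exists_orthogonal_part {X Z : Type*} [NormedAddCommGroup X] [NormedSpace ℝ X]
    [NormedAddCommGroup Z] [InnerProductSpace ℝ Z] (τ : X →L[ℝ] Z) (W : Submodule ℝ X)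
    [FiniteDimensional ℝ W] (hinj : ∀ s ∈ W, τ s = 0 → s = 0) :
    ∃ Q : X →L[ℝ] X, (∀ v, v - Q v ∈ W) ∧ ∀ v, ∀ s ∈ W, inner ℝ (τ (Q v)) (τ s) = 0 := by
  set ι : W →ₗ[ℝ] Z := (τ : X →ₗ[ℝ] Z).domRestrict W with hι
  have hι_inj : Function.Injective ι := by
    refine (injective_iff_map_eq_zero ι).2 fun s hs => Subtype.ext (hinj s s.2 hs)
  set e := LinearEquiv.ofInjective ι hι_inj
  set Q₀ : X →L[ℝ] X := W.subtypeL.comp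
    ((LinearMap.toContinuousLinearMap (e.symm : LinearMap.range ι →ₗ[ℝ] W)).comp
      ((LinearMap.range ι).orthogonalProjectionOnto.comp τ)) with hQ₀
  have hmem : ∀ v, Q₀ v ∈ W := fun v => Submodule.coe_mem _
  have hτ : ∀ v, τ (Q₀ v) = (LinearMap.range ι).starProjection (τ v) := fun v => by
    have h := LinearEquiv.apply_symm_apply e ((LinearMap.range ι).orthogonalProjectionOnto (τ v))
    exact congrArg Subtype.val h
  refine ⟨ContinuousLinearMap.id ℝ X - Q₀, fun v => ?_, fun v s hs => ?_⟩
  · simpa using hmem v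
  · have h1 : τ s ∈ LinearMap.range ι := ⟨⟨s, hs⟩, rfl⟩
    simp only [sub_apply, ContinuousLinearMap.id_apply, map_sub, hτ]
    exact Submodule.starProjection_inner_eq_zero _ _ h1

/-- Derivatives of curves in a closed subspace lie in it. -/
lemma IsTimeDeriv.ae_mem {X : Type*} [NormedAddCommGroup X] [NormedSpace ℝ X] [CompleteSpace X]
    {φ φ' : ℝ → X} (h : IsTimeDeriv φ φ') {S : Submodule ℝ X} (hS : IsClosed (S : Set X))
    (hφ : ∀ t, 0 ≤ t → φ t ∈ S) : ∀ᵐ t ∂(volume.restrict (Ici (0 : ℝ))), φ' t ∈ S := by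
  have h0 : ∀ᵐ t ∂(volume.restrict (Ici (0 : ℝ))), t ≠ 0 :=
    ae_restrict_of_ae (by simp [ae_iff, measure_singleton])
  filter_upwards [h.ae_hasDerivAt, h0, ae_restrict_mem measurableSet_Ici] with t ht ht0 htn
  have hpos : 0 < t := lt_of_le_of_ne htn (Ne.symm ht0)
  refine hS.mem_of_tendsto ht.tendsto_slope ?_
  filter_upwards [nhdsWithin_le_nhds (lt_mem_nhds hpos)] with s hs
  rw [slope_def_module]
  exact S.smul_mem _ (S.sub_mem (hφ s hs.le) (hφ t hpos.le))

/-- The Lyapunov function `Λ e + (τ Q θ_t, τ Q θ)`, equivalent to the energy `e`, yields a bound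
uniform in time. -/
theorem energy_le_of_lyapunov {X Z Zs : Type*} [NormedAddCommGroup X] [NormedSpace ℝ X]
    [CompleteSpace X] [NormedAddCommGroup Z] [InnerProductSpace ℝ Z] [CompleteSpace Z]
    [NormedAddCommGroup Zs] [InnerProductSpace ℝ Zs] [CompleteSpace Zs]
    (τ : X →L[ℝ] Z) (d : X →L[ℝ] Zs) (Q : X →L[ℝ] X) {θ θ₁ θ₂ : ℝ → X}
    (h₁ : IsTimeDeriv θ θ₁) (h₂ : IsTimeDeriv θ₁ θ₂) {b ν Λ C : ℝ} {e : ℝ → ℝ}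
    (he : ∀ t, e t = 1 / 2 * ‖τ (θ₁ t)‖ ^ 2 + b / 2 * ‖d (θ t)‖ ^ 2)
    (hν : 0 ≤ ν) (hΛ : ν < Λ) (hC : 0 ≤ C)
    (hX : ∀ t, 0 ≤ t → ‖τ (Q (θ₁ t))‖ * ‖τ (Q (θ t))‖ ≤ ν * e t)
    (hdiss : ∀ᵐ t ∂(volume.restrict (Ici (0 : ℝ))),
      inner ℝ (τ (Q (θ₂ t))) (τ (Q (θ t))) + ‖τ (Q (θ₁ t))‖ ^ 2
        + Λ * (inner ℝ (τ (θ₂ t)) (τ (θ₁ t)) + b * inner ℝ (d (θ t)) (d (θ₁ t))) + e t ≤ C)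
    (he0 : e 0 = 0) {t : ℝ} (ht : 0 ≤ t) : (Λ - ν) * e t ≤ (Λ + ν) * C := by
  have hXabs : ∀ s, 0 ≤ s → |inner ℝ (τ (Q (θ₁ s))) (τ (Q (θ s)))| ≤ ν * e s := fun s hs =>
    (abs_real_inner_le_norm _ _).trans (hX s hs)
  have i₁ := h₂.clm τ
  have i₂ := h₁.clm d
  have i₃ := h₁.clm (τ.comp Q)
  have i₄ := h₂.clm (τ.comp Q)
  simp only [ContinuousLinearMap.comp_apply] at i₃ i₄
  set Y : ℝ → ℝ := fun s => inner ℝ (τ (Q (θ₁ s))) (τ (Q (θ s)))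
    + (Λ / 2 * inner ℝ (τ (θ₁ s)) (τ (θ₁ s)) + Λ * b / 2 * inner ℝ (d (θ s)) (d (θ s))) with hY
  have hYe : ∀ s, Y s = inner ℝ (τ (Q (θ₁ s))) (τ (Q (θ s))) + Λ * e s := fun s => by
    simp only [hY, he, real_inner_self_eq_norm_sq]; ring
  have hYt : Y t ≤ (Λ + ν) * C := by
    refine lyapunov_bound (Y := Y) (e := e) (Y' := fun s =>
      inner ℝ (τ (Q (θ₂ s))) (τ (Q (θ s))) + ‖τ (Q (θ₁ s))‖ ^ 2
        + Λ * (inner ℝ (τ (θ₂ s)) (τ (θ₁ s)) + b * inner ℝ (d (θ s)) (d (θ₁ s))))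
      (by linarith) hC ?_ ?_ ?_ ?_ ht
    · intro T hT
      have a₁ := i₁.absolutelyContinuousOnInterval hT
      have a₂ := i₂.absolutelyContinuousOnInterval hT
      exact (absolutelyContinuousOnInterval_inner (i₄.absolutelyContinuousOnInterval hT)
        (i₃.absolutelyContinuousOnInterval hT)).fun_add
        (((absolutelyContinuousOnInterval_inner a₁ a₁).const_mul _).fun_add
          ((absolutelyContinuousOnInterval_inner a₂ a₂).const_mul _))
    · filter_upwards [hdiss, i₁.ae_hasDerivAt, i₂.ae_hasDerivAt, i₃.ae_hasDerivAt,
        i₄.ae_hasDerivAt] with s hs d₁ d₂ d₃ d₄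
      refine ⟨?_, hs⟩
      refine ((d₄.inner ℝ d₃).add (((d₁.inner ℝ d₁).const_mul (Λ / 2)).add
        ((d₂.inner ℝ d₂).const_mul (Λ * b / 2)))).congr_deriv ?_
      rw [real_inner_self_eq_norm_sq, real_inner_comm (τ (θ₂ s)), real_inner_comm (d (θ₁ s))]
      ring
    · intro s hs
      rw [hYe]
      linarith [(abs_le.1 (hXabs s hs)).2]
    · have h3 := hXabs 0 le_rfl
      rw [hYe, he0]
      rw [he0] at h3
      linarith [(abs_le.1 h3).2]
  rw [hYe] at hYt
  linarith [(abs_le.1 (hXabs t ht)).1]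

lemma mul_le_young {a p q y b : ℝ} (ha : 0 ≤ a) (hb : 0 < b) (hq : q ≤ p * y) :
    a * q ≤ b / 6 * y ^ 2 + 3 / (2 * b) * p ^ 2 * a ^ 2 := by
  have h1 : a * q ≤ a * (p * y) := mul_le_mul_of_nonneg_left hq ha
  have h2 : b / 6 * y ^ 2 + 3 / (2 * b) * p ^ 2 * a ^ 2 - a * (p * y)
      = (b * y - 3 * p * a) ^ 2 / (6 * b) := by
    field_simp; ring
  have h3 : 0 ≤ (b * y - 3 * p * a) ^ 2 / (6 * b) := by positivity
  linarith

/-- The differential inequality for the Lyapunov function, in terms of the norms involved: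
`n = ‖θ_t‖_{1/H}`, `m = ‖θ_t‖`, `q = ‖Q θ‖_{1/H}`, `z = ‖Q θ_t‖_{1/H}`, `y = ‖∇ · θ‖`; `c`, `γ`, `r'`
are the Coriolis, damping and residual terms tested with `Q θ`, and `D`, `r` the damping and
residual terms tested with `θ_t`. -/
lemma dissipation_inequality {b p w c₀ c₁ C₁ C₂ δ Λ N A' n m q z y c γ Γ r r' D X₂ E' : ℝ}
    (hb : 0 < b) (hw : 0 ≤ w) (hc₀ : 0 ≤ c₀) (hδ : 0 ≤ δ)
    (hn : 0 ≤ n) (hz : 0 ≤ z) (hΓ : 0 ≤ Γ)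
    (hc₁ : 3 / (2 * b) * p ^ 2 * c₀ ^ 2 = c₁) (hC₂ : 3 / (2 * b) * p ^ 2 * w ^ 2 = C₂)
    (hC₁ : (2 + c₁) * n ^ 2 ≤ C₁ * m ^ 2) (hC₁0 : 0 ≤ C₁) (hC₂0 : 0 ≤ C₂) (hΛ : 0 ≤ Λ)
    (hN : (C₁ + C₂) * N = Λ)
    (hqy : q ≤ p * y) (hzn : z ≤ n)
    (hc : -c ≤ c₀ * n * q) (hγ : -γ ≤ Γ * w * q) (hr' : r' ≤ δ * w * q) (hr : r ≤ δ * w * n)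
    (hctrl : m ^ 2 + Γ ^ 2 ≤ A' + N * D)
    (h₁ : E' + D = r) (h₂ : X₂ + c + b * y ^ 2 + γ = r') :
    X₂ + z ^ 2 + Λ * E' + (1 / 2 * n ^ 2 + b / 2 * y ^ 2)
      ≤ C₂ * δ ^ 2 + (C₁ + C₂) * A' + 1 / 2 * w ^ 2 * (Λ * δ) ^ 2 := by
  have y₁ := mul_le_young (a := c₀ * n) (by positivity) hb hqy
  have y₂ := mul_le_young (a := Γ * w) (by positivity) hb hqy
  have y₃ := mul_le_young (a := δ * w) (by positivity) hb hqy
  have e₁ : 3 / (2 * b) * p ^ 2 * (c₀ * n) ^ 2 = c₁ * n ^ 2 := by rw [← hc₁]; ring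
  have e₂ : 3 / (2 * b) * p ^ 2 * (Γ * w) ^ 2 = C₂ * Γ ^ 2 := by rw [← hC₂]; ring
  have e₃ : 3 / (2 * b) * p ^ 2 * (δ * w) ^ 2 = C₂ * δ ^ 2 := by rw [← hC₂]; ring
  rw [e₁] at y₁
  rw [e₂] at y₂
  rw [e₃] at y₃
  have hz2 : z ^ 2 ≤ n ^ 2 := pow_le_pow_left₀ hz hzn 2
  have k₁ := mul_le_mul_of_nonneg_left hctrl (add_nonneg hC₁0 hC₂0)
  have k₂ : (C₁ + C₂) * (A' + N * D) = (C₁ + C₂) * A' + Λ * D := by rw [← hN]; ring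
  rw [k₂] at k₁
  have k₃ : Λ * D ≤ Λ * (δ * w * n) - Λ * E' := by
    have h := mul_le_mul_of_nonneg_left hr hΛ
    have h' : Λ * D = Λ * r - Λ * E' := by rw [← h₁]; ring
    linarith
  have k₄ : Λ * (δ * w * n) ≤ 1 / 2 * n ^ 2 + 1 / 2 * w ^ 2 * (Λ * δ) ^ 2 := by
    have h : 1 / 2 * n ^ 2 + 1 / 2 * w ^ 2 * (Λ * δ) ^ 2 - Λ * (δ * w * n)
        = 1 / 2 * (n - Λ * δ * w) ^ 2 := by ring
    have h' := sq_nonneg (n - Λ * δ * w)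
    linarith
  clear h₁ hr hctrl hC₂ hc₁ e₁ e₂ e₃ hqy hN k₂
  have k₇ : (C₁ + C₂) * (m ^ 2 + Γ ^ 2) = C₁ * m ^ 2 + C₂ * m ^ 2 + C₁ * Γ ^ 2 + C₂ * Γ ^ 2 := by
    ring
  have k₈ : (2 + c₁) * n ^ 2 = 2 * n ^ 2 + c₁ * n ^ 2 := by ring
  rw [k₇] at k₁
  rw [k₈] at hC₁
  have k₅ : 0 ≤ C₁ * Γ ^ 2 := by positivity
  have k₆ : 0 ≤ C₂ * m ^ 2 := by positivity
  linarith

/-- The bound for the product of the norms of `Q θ_t` and `Q θ` by the energy. -/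
lemma mul_le_energy {n q z y p b : ℝ} (hb : 0 < b) (hp : 0 ≤ p) (hn : 0 ≤ n) (hq : 0 ≤ q)
    (hzn : z ≤ n) (hqy : q ≤ p * y) :
    z * q ≤ p / √b * (1 / 2 * n ^ 2 + b / 2 * y ^ 2) := by
  have hs : 0 < √b := Real.sqrt_pos.2 hb
  have hsq : b = √b ^ 2 := (Real.sq_sqrt hb.le).symm
  have h1 : z * q ≤ n * (p * y) :=
    (mul_le_mul_of_nonneg_right hzn hq).trans (mul_le_mul_of_nonneg_left hqy hn)
  have h2 : p / √b * (1 / 2 * n ^ 2 + b / 2 * y ^ 2) - n * (p * y)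
      = p / √b * (1 / 2 * (n - √b * y) ^ 2) := by
    generalize √b = s at hs hsq
    subst hsq
    field_simp
    ring
  have h3 : 0 ≤ p / √b * (1 / 2 * (n - √b * y) ^ 2) := by positivity
  linarith

/-! ### Weak limits in Sobolev spaces -/

lemma memLp_test {Ω : Set E2} {ψ : E2 → ℝ} (hψ : ContDiff ℝ ∞ ψ) (hc : HasCompactSupport ψ) :
    MemLp ψ 2 (volume.restrict Ω) :=
  hψ.continuous.memLp_of_hasCompactSupport hc

lemma memLp_mpartial_test {Ω : Set E2} {ψ : E2 → ℝ} (hψ : ContDiff ℝ ∞ ψ)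
    (hc : HasCompactSupport ψ) (a b : ℕ) : MemLp (mpartial a b ψ) 2 (volume.restrict Ω) := by
  have h1 : Continuous (iteratedFDeriv ℝ (a + b) ψ) :=
    hψ.continuous_iteratedFDeriv (by exact_mod_cast le_top)
  have h2 : Continuous (mpartial a b ψ) := by
    unfold mpartial
    exact (continuous_eval_const _).comp h1
  refine h2.memLp_of_hasCompactSupport ?_
  exact (hc.iteratedFDeriv (a + b)).comp_left
    (g := fun m : ContinuousMultilinearMap ℝ (fun _ : Fin (a + b) => E2) ℝ => m _) rfl

/-- A bound for weak derivatives passes to limits in `L²(Ω)`, by weak compactness of balls. -/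
theorem exists_hasWeakDeriv_of_tendsto {Ω : Set E2} {a b : ℕ} {ι : Type*} {l : Filter ι} [l.NeBot]
    {q w : ι → L2s Ω} {q₀ : L2s Ω} (hq : Tendsto q l (𝓝 q₀)) {K : ℝ}
    (hw : ∀ i, HasWeakDeriv a b (q i) (w i)) (hK : ∀ i, ‖w i‖ ≤ K) :
    ∃ w₀ : L2s Ω, HasWeakDeriv a b q₀ w₀ := by
  set F : ι → WeakDual ℝ (L2s Ω) := fun i =>
    StrongDual.toWeakDual (InnerProductSpace.toDual ℝ (L2s Ω) (w i)) with hF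
  set U : Ultrafilter ι := Ultrafilter.of l
  have hU : (U : Filter ι) ≤ l := Ultrafilter.of_le l
  obtain ⟨x, -, hx⟩ := (WeakDual.isCompact_closedBall (𝕜 := ℝ) (E := L2s Ω) 0 K).ultrafilter_le_nhds
    (U.map F) (by
      rw [le_principal_iff, Ultrafilter.coe_map, Filter.mem_map]
      refine mem_of_superset univ_mem fun i _ => ?_
      simpa [hF] using hK i)
  set w₀ := (InnerProductSpace.toDual ℝ (L2s Ω)).symm (WeakDual.toStrongDual x) with hw₀
  refine ⟨w₀, fun ψ hψ hc hs => ?_⟩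
  have hP := memLp_mpartial_test (Ω := Ω) hψ hc a b
  have hT := memLp_test (Ω := Ω) hψ hc
  have e₁ : ∀ r : L2s Ω, ∫ x in Ω, r x * mpartial a b ψ x = inner ℝ r hP.toLp := fun r => by
    rw [L2.inner_def]
    refine integral_congr_ae ?_
    filter_upwards [hP.coeFn_toLp] with y hy
    rw [hy]
    simp [mul_comm]
  have e₂ : ∀ r : L2s Ω, ∫ x in Ω, r x * ψ x = inner ℝ r hT.toLp := fun r => by
    rw [L2.inner_def]
    refine integral_congr_ae ?_
    filter_upwards [hT.coeFn_toLp] with y hy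
    rw [hy]
    simp [mul_comm]
  have t₁ : Tendsto (fun i => inner ℝ (q i) hP.toLp) U (𝓝 (inner ℝ q₀ hP.toLp)) :=
    (hq.mono_left hU).inner tendsto_const_nhds
  have t₂ : Tendsto (fun i => inner ℝ (w i) hT.toLp) U (𝓝 (inner ℝ w₀ hT.toLp)) := by
    have h1 : Tendsto (fun i => F i hT.toLp) U (𝓝 (x hT.toLp)) :=
      ((WeakDual.eval_continuous hT.toLp).tendsto x).comp hx
    have h2 : inner ℝ w₀ hT.toLp = x hT.toLp := by
      rw [hw₀, InnerProductSpace.toDual_symm_apply]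
      rfl
    rw [h2]
    refine h1.congr fun i => ?_
    simp [hF]
  rw [e₁, e₂]
  refine tendsto_nhds_unique t₁ ((t₂.const_mul _).congr fun i => ?_)
  rw [← e₁, ← e₂]
  exact (hw i ψ hψ hc hs).symm

lemma hasWeakDeriv_weakDeriv {Ω : Set E2} {a b : ℕ} {q : L2s Ω}
    (h : ∃ w : L2s Ω, HasWeakDeriv a b q w) : HasWeakDeriv a b q (weakDeriv a b q) := by
  rw [weakDeriv, dif_pos h]
  exact h.choose_spec

lemma norm_weakDeriv_le {Ω : Set E2} {a b k : ℕ} (hab : a + b ≤ k) (v : L2v Ω) (i : Fin 2) :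
    ‖weakDeriv a b (comp v i)‖ ≤ vnormHk k v := by
  have h1 : ‖weakDeriv a b (comp v i)‖ ≤ seminormHk (a + b) (comp v i) := by
    refine Real.le_sqrt_of_sq_le ?_
    have h := Finset.single_le_sum
      (f := fun j => ‖weakDeriv j (a + b - j) (comp v i)‖ ^ 2)
      (fun j _ => sq_nonneg _) (Finset.mem_range.2 (by omega : a < a + b + 1))
    simpa using h
  have h2 : seminormHk (a + b) (comp v i) ≤ vseminormHk (a + b) v :=
    Real.le_sqrt_of_sq_le (Finset.single_le_sum
      (f := fun i => seminormHk (a + b) (comp v i) ^ 2) (fun j _ => sq_nonneg _)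
      (Finset.mem_univ i))
  have h3 : vseminormHk (a + b) v ≤ vnormHk k v :=
    Real.le_sqrt_of_sq_le (Finset.single_le_sum
      (f := fun j => vseminormHk j v ^ 2) (fun j _ => sq_nonneg _)
      (Finset.mem_range.2 (by omega : a + b < k + 1)))
  exact h1.trans (h2.trans h3)

/-- A continuous curve in `L²(Ω)²` that is bounded in `H^k(Ω)²` for almost every time lies in
`H^k(Ω)²` at every time. -/
theorem LinftyHk.vmemHk {Ω : Set E2} {k : ℕ} {v : ℝ → L2v Ω} (hv : LinftyHk k v)
    (hc : ContinuousOn v (Ici 0)) {t : ℝ} (ht : 0 ≤ t) : VMemHk k (v t) := by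
  obtain ⟨K, hK⟩ := hv (t + 1) (by linarith)
  have hex : ∀ n : ℕ, ∃ s, t < s ∧ s < t + 1 / ((n : ℝ) + 1) ∧ VMemHk k (v s) ∧
      vnormHk k (v s) ≤ K := by
    intro n
    have hn : 0 < 1 / ((n : ℝ) + 1) := Nat.one_div_pos_of_nat
    have hn1 : 1 / ((n : ℝ) + 1) ≤ 1 := by
      rw [div_le_one (by positivity)]
      linarith [n.cast_nonneg (α := ℝ)]
    have h1 := ae_restrict_of_ae_restrict_of_subset
      (show Ioo t (t + 1 / ((n : ℝ) + 1)) ⊆ Ioo 0 (t + 1) from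
        fun s hs => ⟨ht.trans_lt hs.1, hs.2.trans_le (by linarith)⟩) hK
    have : (ae (volume.restrict (Ioo t (t + 1 / ((n : ℝ) + 1))))).NeBot := by
      rw [ae_neBot, Ne, Measure.restrict_eq_zero, Real.volume_Ioo]
      simpa using hn
    obtain ⟨s, hs, hs'⟩ := (h1.and (ae_restrict_mem measurableSet_Ioo)).exists
    exact ⟨s, hs'.1, hs'.2, hs.1, hs.2⟩
  choose s hs₁ hs₂ hs₃ hs₄ using hex
  have hst : Tendsto s atTop (𝓝[Ici 0] t) := by
    refine tendsto_nhdsWithin_iff.2 ⟨?_, Eventually.of_forall fun n => ht.trans (hs₁ n).le⟩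
    refine tendsto_of_tendsto_of_tendsto_of_le_of_le tendsto_const_nhds ?_
      (fun n => (hs₁ n).le) (fun n => (hs₂ n).le)
    simpa using tendsto_one_div_add_atTop_nhds_zero_nat.const_add t
  have hvt : Tendsto (fun n => v (s n)) atTop (𝓝 (v t)) := (hc t ht).tendsto.comp hst
  intro i a b hab
  have hcomp : Continuous fun u : L2v Ω => comp u i :=
    ((EuclideanSpace.proj i : E2 →L[ℝ] ℝ).compLpL 2 (volume.restrict Ω)).continuous
  exact exists_hasWeakDeriv_of_tendsto ((hcomp.tendsto _).comp hvt)
    (fun n => hasWeakDeriv_weakDeriv (hs₃ n i a b hab))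
    (fun n => (norm_weakDeriv_le hab _ i).trans (hs₄ n))

/-! ### The error equation -/

/-- The underlying field, as a bounded linear map on `H(div)`. -/
noncomputable def fldL (Ω : Set E2) : Hdiv Ω →L[ℝ] L2v Ω :=
  (ContinuousLinearMap.fst ℝ (L2v Ω) (L2s Ω)).comp (Hdiv Ω).subtypeL

/-- The weak divergence, as a bounded linear map on `H(div)`. -/
noncomputable def dvgL (Ω : Set E2) : Hdiv Ω →L[ℝ] L2s Ω :=
  (ContinuousLinearMap.snd ℝ (L2v Ω) (L2s Ω)).comp (Hdiv Ω).subtypeL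

@[simp] lemma fldL_apply {Ω : Set E2} (v : Hdiv Ω) : fldL Ω v = fld v := rfl

@[simp] lemma dvgL_apply {Ω : Set E2} (v : Hdiv Ω) : dvgL Ω v = dvg v := rfl

lemma fld_sub {Ω : Set E2} (v w : Hdiv Ω) : fld (v - w) = fld v - fld w := rfl

lemma dvg_sub {Ω : Set E2} (v w : Hdiv Ω) : dvg (v - w) = dvg v - dvg w := rfl

lemma dvg_neg {Ω : Set E2} (v : Hdiv Ω) : dvg (-v) = -dvg v := rfl

instance completeSpace_Hdiv (Ω : Set E2) : CompleteSpace (Hdiv Ω) := by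
  have h : IsClosed ((Hdiv Ω : Submodule ℝ (L2v Ω × L2s Ω)) : Set (L2v Ω × L2s Ω)) := by
    have h1 : ((Hdiv Ω : Submodule ℝ (L2v Ω × L2s Ω)) : Set (L2v Ω × L2s Ω))
        = ⋂ (q : L2s Ω) (G : L2v Ω) (_ : HasWeakGrad q G),
          {p | inner ℝ p.1 G + inner ℝ p.2 q = 0} := by
      ext p
      simp only [mem_iInter]
      rfl
    rw [h1]
    refine isClosed_iInter fun q => isClosed_iInter fun G => isClosed_iInter fun _ =>
      isClosed_eq ?_ continuous_const
    fun_prop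
  exact h.completeSpace_coe

lemma MixedPair.dvg_proj {Ω : Set E2} {k : ℕ} {h : ℝ} {Vh : Submodule ℝ (Hdiv Ω)}
    {Wh : Submodule ℝ (L2s Ω)} [FiniteDimensional ℝ Wh] {P : Hdiv Ω →L[ℝ] Hdiv Ω}
    {Cproj Cscal : ℝ} (hp : MixedPair k h Vh Wh P Cproj Cscal) (v : Hdiv Ω) :
    dvg (P v) = Wh.starProjection (dvg v) := by
  have h1 : dvg (P v) - Wh.starProjection (dvg v) ∈ Wh :=
    Wh.sub_mem (hp.dvg_mem _ (hp.proj_mem v)) (Submodule.starProjection_apply_mem _ _)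
  have h2 := hp.commute v _ h1
  rw [← sub_eq_zero, ← inner_self_eq_zero (𝕜 := ℝ), inner_sub_left, h2, sub_self]

lemma vseminormHk_nonneg {Ω : Set E2} (k : ℕ) (v : L2v Ω) : 0 ≤ vseminormHk k v :=
  Real.sqrt_nonneg _

/-- The equation for the error `Π φ - φ_h` at one instant, tested with `v ∈ V_h`: the left-hand side
is that of the discrete problem, and the pressure term of the residual drops out because
`∇ · Π φ = π ∇ · φ`. -/
lemma error_equation {Ω : Set E2} {H f : E2 → ℝ} {ε β : ℝ} {g : E2 → E2 → E2}
    {k : ℕ} {h Cproj Cscal : ℝ} {Vh : Submodule ℝ (Hdiv Ω)} {Wh : Submodule ℝ (L2s Ω)}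
    [FiniteDimensional ℝ Wh] {P : Hdiv Ω →L[ℝ] Hdiv Ω}
    (hp : MixedPair k h Vh Wh P Cproj Cscal) {T S : L2v Ω →L[ℝ] L2v Ω} {G : L2v Ω → L2v Ω}
    (hT : ∀ u v, winner (fun x => 1 / H x) u v = inner ℝ (T u) (T v))
    (hTs : ∀ u v, inner ℝ (T u) v = inner ℝ u (T v))
    (hS : ∀ u v, ∫ x in Ω, f x / (H x * ε) * inner ℝ (rot (u x)) (v x) = inner ℝ (S (T u)) (T v))
    (hG : ∀ u, ∀ᵐ x ∂(volume.restrict Ω), G u x = g x (u x))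
    {F : L2v Ω} {φ φ₁ φ₂ φh φh₁ φh₂ v : Hdiv Ω} (hv : v ∈ Vh)
    (h₁ : winner (fun x => 1 / H x) (fld φ₂) (fld v)
      + (∫ x in Ω, f x / (H x * ε) * inner ℝ (rot (fld φ₁ x)) (fld v x))
      + β / ε ^ 2 * inner ℝ (dvg φ) (dvg v)
      + (∫ x in Ω, inner ℝ (g x (fld φ₁ x)) (fld v x)) = inner ℝ F (fld v))
    (h₂ : winner (fun x => 1 / H x) (fld φh₂) (fld v)
      + (∫ x in Ω, f x / (H x * ε) * inner ℝ (rot (fld φh₁ x)) (fld v x))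
      + β / ε ^ 2 * inner ℝ (dvg φh) (dvg v)
      + (∫ x in Ω, inner ℝ (g x (fld φh₁ x)) (fld v x)) = inner ℝ F (fld v)) :
    inner ℝ (T (fld (P φ₂ - φh₂))) (T (fld v))
      + inner ℝ (S (T (fld (P φ₁ - φh₁)))) (T (fld v))
      + β / ε ^ 2 * inner ℝ (dvg (P φ - φh)) (dvg v)
      + inner ℝ (G (fld (P φ₁)) - G (fld φh₁)) (fld v)
      = inner ℝ (T (T (fld (P φ₂ - φ₂))) + T (S (T (fld (P φ₁ - φ₁))))
          + (G (fld (P φ₁)) - G (fld φ₁))) (fld v) := by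
  have h3 : inner ℝ (dvg (P φ)) (dvg v) = inner ℝ (dvg φ) (dvg v) := by
    rw [hp.dvg_proj, Submodule.inner_starProjection_left_eq_right,
      Submodule.starProjection_eq_self_iff.2 (hp.dvg_mem v hv)]
  rw [hT, hS, damping_operator_inner hG] at h₁ h₂
  simp only [fld_sub, dvg_sub, map_sub, inner_sub_left, inner_add_left, hTs, h3] at h₁ h₂ ⊢
  linarith

/-- The residual of the projected solution. -/
lemma norm_residual_le {Ω : Set E2} {ε Hlo fmax M : ℝ} (hε : 0 < ε) (hlo : 0 < Hlo)
    (hf : 0 ≤ fmax) (hM : 0 < M)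
    {k : ℕ} {h Cproj Cscal : ℝ} {Vh : Submodule ℝ (Hdiv Ω)} {Wh : Submodule ℝ (L2s Ω)}
    [FiniteDimensional ℝ Wh] {P : Hdiv Ω →L[ℝ] Hdiv Ω}
    (hp : MixedPair k h Vh Wh P Cproj Cscal) {T S : L2v Ω →L[ℝ] L2v Ω} {G : L2v Ω → L2v Ω}
    (hTn : ∀ u, ‖T u‖ ^ 2 ≤ 1 / Hlo * ‖u‖ ^ 2) (hSn : ∀ u, ‖S u‖ ≤ fmax / ε * ‖u‖)
    (hGn : ∀ u v, ‖G u - G v‖ ≤ M * ‖u - v‖) {φ₁ φ₂ : Hdiv Ω}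
    (h₁ : VMemHk k (fld φ₁)) (h₂ : VMemHk k (fld φ₂)) :
    ‖T (T (fld (P φ₂ - φ₂))) + T (S (T (fld (P φ₁ - φ₁)))) + (G (fld (P φ₁)) - G (fld φ₁))‖
      ≤ kappa k ε Hlo fmax M Cproj (fld φ₁) (fld φ₂) * h ^ k := by
  have hT' : ∀ u, ‖T u‖ ≤ √(1 / Hlo) * ‖u‖ := fun u => by
    refine le_of_sq_le_sq ?_ (by positivity)
    rw [mul_pow, Real.sq_sqrt (by positivity)]
    exact hTn u
  have hss : √(1 / Hlo) * √(1 / Hlo) = 1 / Hlo := Real.mul_self_sqrt (by positivity)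
  have b₁ := hp.approx φ₁ h₁
  have b₂ := hp.approx φ₂ h₂
  rw [norm_sub_rev] at b₁ b₂
  have c₁ : ‖T (T (fld (P φ₂ - φ₂)))‖ ≤ 1 / Hlo * (Cproj * h ^ k * vseminormHk k (fld φ₂)) := by
    calc _ ≤ √(1 / Hlo) * (√(1 / Hlo) * ‖fld (P φ₂ - φ₂)‖) :=
          (hT' _).trans (mul_le_mul_of_nonneg_left (hT' _) (Real.sqrt_nonneg _))
      _ = 1 / Hlo * ‖fld (P φ₂ - φ₂)‖ := by rw [← mul_assoc, hss]
      _ ≤ _ := mul_le_mul_of_nonneg_left b₂ (by positivity)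
  have c₂ : ‖T (S (T (fld (P φ₁ - φ₁))))‖
      ≤ fmax / (Hlo * ε) * (Cproj * h ^ k * vseminormHk k (fld φ₁)) := by
    calc _ ≤ √(1 / Hlo) * (fmax / ε * (√(1 / Hlo) * ‖fld (P φ₁ - φ₁)‖)) :=
          (hT' _).trans (mul_le_mul_of_nonneg_left ((hSn _).trans
            (mul_le_mul_of_nonneg_left (hT' _) (by positivity))) (Real.sqrt_nonneg _))
      _ = (√(1 / Hlo) * √(1 / Hlo)) * (fmax / ε) * ‖fld (P φ₁ - φ₁)‖ := by ring
      _ = fmax / (Hlo * ε) * ‖fld (P φ₁ - φ₁)‖ := by rw [hss]; congr 1; field_simp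
      _ ≤ _ := mul_le_mul_of_nonneg_left b₁ (by positivity)
  have c₃ : ‖G (fld (P φ₁)) - G (fld φ₁)‖
      ≤ M * (Cproj * h ^ k * vseminormHk k (fld φ₁)) :=
    (hGn _ _).trans (mul_le_mul_of_nonneg_left b₁ hM.le)
  refine (norm_add₃_le).trans ?_
  have e : kappa k ε Hlo fmax M Cproj (fld φ₁) (fld φ₂) * h ^ k
      = 1 / Hlo * (Cproj * h ^ k * vseminormHk k (fld φ₂))
        + fmax / (Hlo * ε) * (Cproj * h ^ k * vseminormHk k (fld φ₁))
        + M * (Cproj * h ^ k * vseminormHk k (fld φ₁)) := by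
    unfold kappa; ring
  rw [e]
  exact add_le_add (add_le_add c₁ c₂) c₃

lemma kappa_nonneg {Ω : Set E2} {k : ℕ} {ε Hlo fmax M Cproj : ℝ} (hε : 0 < ε) (hlo : 0 < Hlo)
    (hf : 0 ≤ fmax) (hM : 0 < M) (hC : 0 < Cproj) (u v : L2v Ω) :
    0 ≤ kappa k ε Hlo fmax M Cproj u v := by
  have h1 := vseminormHk_nonneg k u
  have h2 := vseminormHk_nonneg k v
  unfold kappa
  positivity

/-- The discrete Poincaré–Friedrichs inequality with the unweighted norm of the divergence. -/
lemma PoincareFriedrichs.norm_le {Ω : Set E2} {H f : E2 → ℝ} {Hlo Hhi fmax CP : ℝ}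
    (hc : CoeffBounds Ω H f Hlo Hhi fmax) (hCP : 0 < CP) {Vh : Submodule ℝ (Hdiv Ω)}
    (hPF : PoincareFriedrichs H Vh CP) {T : L2v Ω →L[ℝ] L2v Ω}
    (hT : ∀ u v, winner (fun x => 1 / H x) u v = inner ℝ (T u) (T v)) {v : Hdiv Ω} (hv : v ∈ Vh)
    (ho : ∀ s ∈ Vh, dvg s = 0 → inner ℝ (T (fld v)) (T (fld s)) = 0) :
    ‖T (fld v)‖ ≤ CP * √(1 / Hlo) * ‖dvg v‖ := by
  have h1 := hPF v hv (fun s hs hs0 => by rw [hT]; exact ho s hs hs0)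
  rw [hT, real_inner_self_eq_norm_sq, Real.sqrt_sq (norm_nonneg _)] at h1
  have h2 := Real.sqrt_le_sqrt (integral_weight_sq_le hc (dvg v))
  have hlo := hc.lo_pos
  rw [Real.sqrt_mul (by positivity), Real.sqrt_sq (norm_nonneg _)] at h2
  calc _ ≤ _ := h1
    _ ≤ CP * (√(1 / Hlo) * ‖dvg v‖) := mul_le_mul_of_nonneg_left h2 hCP.le
    _ = _ := by ring

/-! ### Constants -/

lemma const2_eq {ε β Hlo Hhi CP : ℝ} (hε : 0 < ε) (hβ : 0 < β) (hlo : 0 < Hlo) (hhi : 0 < Hhi) :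
    3 / (2 * (β / ε ^ 2)) * (CP * √(1 / Hlo)) ^ 2 * √Hhi ^ 2 = const2 ε β Hlo Hhi CP := by
  rw [mul_pow, Real.sq_sqrt (by positivity), Real.sq_sqrt hhi.le, const2]
  field_simp

lemma const1_eq {ε β Hlo fmax CP : ℝ} (hε : 0 < ε) (hβ : 0 < β) (hlo : 0 < Hlo) :
    const1 β Hlo fmax CP
      = (2 + 3 / (2 * (β / ε ^ 2)) * (CP * √(1 / Hlo)) ^ 2 * (fmax / ε) ^ 2) / Hlo := by
  rw [mul_pow, Real.sq_sqrt (by positivity), const1]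
  congr 2
  field_simp

/-- The coercivity constant `ν` of the cross term is at most a third of `C₁ + C₂`: by the inequality
of the means, `2 / H_* + 3 ν² H^* / 2 ≥ 3 ν`. -/
lemma three_mul_le_const {ε β Hlo Hhi fmax CP : ℝ} (hε : 0 < ε) (hβ : 0 < β) (hlo : 0 < Hlo)
    (hle : Hlo ≤ Hhi) :
    3 * (CP * √(1 / Hlo) / √(β / ε ^ 2)) ≤ const1 β Hlo fmax CP + const2 ε β Hlo Hhi CP := by
  have hhi := hlo.trans_le hle
  set ν := CP * √(1 / Hlo) / √(β / ε ^ 2) with hν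
  have hν2 : ν ^ 2 = (CP * √(1 / Hlo)) ^ 2 / (β / ε ^ 2) := by
    rw [hν, div_pow, Real.sq_sqrt (by positivity)]
  have h1 : 2 / Hlo ≤ const1 β Hlo fmax CP := by
    unfold const1
    gcongr
    have : 0 ≤ 3 * (fmax * CP) ^ 2 / (2 * β * Hlo) := by positivity
    linarith
  have h2 : const2 ε β Hlo Hhi CP = 3 / 2 * ν ^ 2 * Hhi := by
    rw [← const2_eq hε hβ hlo hhi, Real.sq_sqrt hhi.le, hν2]
    field_simp
  have h3 : 3 / 2 * ν ^ 2 * Hlo ≤ 3 / 2 * ν ^ 2 * Hhi := by gcongr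
  have h4 : 3 * ν ≤ 2 / Hlo + 3 / 2 * ν ^ 2 * Hlo := by
    have h5 : 2 / Hlo + 3 / 2 * ν ^ 2 * Hlo - 3 * ν
        = (3 / 2 * (ν * Hlo - 1) ^ 2 + 1 / 2) / Hlo := by
      field_simp; ring
    have h6 : 0 ≤ (3 / 2 * (ν * Hlo - 1) ^ 2 + 1 / 2) / Hlo := by positivity
    linarith
  linarith

lemma const1_pos {β Hlo fmax CP : ℝ} (hβ : 0 < β) (hlo : 0 < Hlo) : 0 < const1 β Hlo fmax CP := by
  unfold const1; positivity

lemma const2_nonneg {ε β Hlo Hhi CP : ℝ} (hβ : 0 < β) (hlo : 0 < Hlo) (hhi : 0 < Hhi) :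
    0 ≤ const2 ε β Hlo Hhi CP := by
  unfold const2; positivity

lemma const3_nonneg {Ω : Set E2} {ε β Hlo Hhi fmax CP M C₀ α : ℝ} (hβ : 0 < β) (hlo : 0 < Hlo)
    (hhi : 0 < Hhi) : 0 ≤ const3 Ω ε β Hlo Hhi fmax CP M C₀ α := by
  have h1 := const1_pos (fmax := fmax) (CP := CP) hβ hlo
  have h2 := const2_nonneg (ε := ε) (CP := CP) hβ hlo hhi
  unfold const3
  have h3 : 0 ≤ volume.real Ω := measureReal_nonneg
  positivity

/-- The choice `σ = δ ^ (2 / (2 - α))` balances the two error contributions. -/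
lemma exists_balanced_parameter {α δ : ℝ} (hα : 0 < α) (hα1 : α < 1) (hδ : 0 < δ) (hδ1 : δ ≤ 1) :
    ∃ σ : ℝ, 0 < σ ∧ σ ≤ 1 ∧ σ ^ α = δ ^ (2 * α / (2 - α)) ∧ 1 ≤ σ ^ (α - 1) ∧
      (σ ^ (α - 1)) ^ 2 * δ ^ 2 = δ ^ (2 * α / (2 - α)) := by
  have h2 : 0 < 2 - α := by linarith
  refine ⟨δ ^ (2 / (2 - α)), by positivity, Real.rpow_le_one hδ.le hδ1 (by positivity), ?_, ?_, ?_⟩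
  · rw [← Real.rpow_mul hδ.le]
    congr 1
    ring
  · exact Real.one_le_rpow_of_pos_of_le_one_of_nonpos (by positivity)
      (Real.rpow_le_one hδ.le hδ1 (by positivity)) (by linarith)
  · rw [← Real.rpow_mul hδ.le, ← Real.rpow_natCast, ← Real.rpow_natCast, ← Real.rpow_mul hδ.le,
      ← Real.rpow_add hδ]
    congr 1
    push_cast
    field_simp
    ring

/-! ### Error estimates -/

/-- Modulo divergence free elements of `V_h`, every field has a representative `Q v` with the same
divergence that is `(H⁻¹ ·, ·)`-orthogonal to them; it is the part to which the discrete
Poincaré–Friedrichs inequality applies. -/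
lemma exists_divergence_splitting {Ω : Set E2} (Vh : Submodule ℝ (Hdiv Ω))
    [FiniteDimensional ℝ Vh] {T : L2v Ω →L[ℝ] L2v Ω} {c : ℝ}
    (hTl : ∀ u, ‖u‖ ^ 2 ≤ c * ‖T u‖ ^ 2) :
    ∃ Q : Hdiv Ω →L[ℝ] Hdiv Ω, (∀ v ∈ Vh, Q v ∈ Vh) ∧ (∀ v, dvg (Q v) = dvg v) ∧
      (∀ v, ‖T (fld (Q v))‖ ≤ ‖T (fld v)‖) ∧
      (∀ u v, inner ℝ (T (fld u)) (T (fld (Q v))) = inner ℝ (T (fld (Q u))) (T (fld (Q v)))) ∧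
      ∀ v, ∀ s ∈ Vh, dvg s = 0 → inner ℝ (T (fld (Q v))) (T (fld s)) = 0 := by
  set W : Submodule ℝ (Hdiv Ω) := Vh ⊓ LinearMap.ker (dvgL Ω : Hdiv Ω →ₗ[ℝ] L2s Ω) with hW
  have hWmem : ∀ {s : Hdiv Ω}, s ∈ W ↔ s ∈ Vh ∧ dvg s = 0 := fun {s} => Iff.rfl
  have : FiniteDimensional ℝ W := Submodule.finiteDimensional_inf_left _ _
  set τ : Hdiv Ω →L[ℝ] L2v Ω := T.comp (fldL Ω) with hτ
  have hτa : ∀ v, τ v = T (fld v) := fun v => rfl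
  obtain ⟨Q, hQW, hQo⟩ := exists_orthogonal_part τ W (fun s hs h0 => by
    have h1 := hTl (fld s)
    rw [← hτa, h0, norm_zero] at h1
    have h2 : fld s = 0 := by
      rw [← norm_eq_zero]
      nlinarith [norm_nonneg (fld s)]
    exact Subtype.ext (Prod.ext h2 (hWmem.1 hs).2))
  simp only [← hτa]
  refine ⟨Q, fun v hv => ?_, fun v => ?_, fun v => ?_, fun u v => ?_, fun v s hs hs0 =>
    hQo v s (hWmem.2 ⟨hs, hs0⟩)⟩
  · have h1 := Vh.sub_mem hv (hWmem.1 (hQW v)).1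
    rwa [sub_sub_cancel] at h1
  · have h1 := (hWmem.1 (hQW v)).2
    rw [dvg_sub, sub_eq_zero] at h1
    exact h1.symm
  · have h1 := norm_add_sq_eq_norm_sq_add_norm_sq_of_inner_eq_zero _ _ (hQo v _ (hQW v))
    rw [← map_add, add_sub_cancel] at h1
    refine le_of_sq_le_sq ?_ (norm_nonneg _)
    nlinarith [norm_nonneg (τ (v - Q v))]
  · rw [← sub_eq_zero, ← inner_sub_left, ← map_sub, real_inner_comm]
    exact hQo _ _ (hQW _)

set_option maxHeartbeats 1000000 in
/-- The energy of the error is bounded uniformly in time by a power of any bound `δ ≤ 1` for the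
residual. The strict positivity of `δ` admits negative powers of `δ` in the weight `Λ` of the
Lyapunov function. -/
theorem error_energy_le {Ω : Set E2} (hΩ : IsOpen Ω) (hΩb : Bornology.IsBounded Ω)
    (hne : Ω.Nonempty) {H f : E2 → ℝ} {Hlo Hhi fmax ε β : ℝ} (hε : 0 < ε) (hβ : 0 < β)
    (hcoef : CoeffBounds Ω H f Hlo Hhi fmax) {g : E2 → E2 → E2} {M : ℝ} (hg : Damping Ω g M)
    {J : ℝ → ℝ} {C₀ α : ℝ} (hJ : DampingProfile Ω g J C₀ α)
    {k : ℕ} {h Cproj Cscal CP : ℝ} {Vh : Submodule ℝ (Hdiv Ω)} [FiniteDimensional ℝ Vh]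
    {Wh : Submodule ℝ (L2s Ω)} [FiniteDimensional ℝ Wh] {P : Hdiv Ω →L[ℝ] Hdiv Ω}
    (hpair : MixedPair k h Vh Wh P Cproj Cscal) (hCP : 0 < CP) (hPF : PoincareFriedrichs H Vh CP)
    {F : ℝ → L2v Ω} {φ φ₁ φ₂ φh φh₁ φh₂ : ℝ → Hdiv Ω}
    (hφ : IsSolution ⊤ H f ε β g F φ φ₁ φ₂) (hφh : IsSolution Vh H f ε β g F φh φh₁ φh₂)
    {δ : ℝ} (hδ : 0 < δ) (hδ1 : δ ≤ 1)
    (hres : ∀ᵐ t ∂(volume.restrict (Ici (0 : ℝ))),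
      VMemHk k (fld (φ₁ t)) ∧ VMemHk k (fld (φ₂ t)) ∧
      kappa k ε Hlo fmax M Cproj (fld (φ₁ t)) (fld (φ₂ t)) * h ^ k ≤ δ)
    (hE0 : energy H ε β (P (φ₁ 0) - φh₁ 0) (P (φ 0) - φh 0) = 0) {t : ℝ} (ht : 0 ≤ t) :
    energy H ε β (P (φ₁ t) - φh₁ t) (P (φ t) - φh t)
      ≤ 3 * const3 Ω ε β Hlo Hhi fmax CP M C₀ α * δ ^ (2 * α / (2 - α)) := by
  have hlo := hcoef.lo_pos
  have hhi : 0 < Hhi := hlo.trans_le hcoef.lo_le_hi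
  obtain ⟨T, S, hT, hTs, hTn, hTl, hS, hSn, hSk⟩ := exists_weight_operators hε hcoef
  obtain ⟨G, hG⟩ := exists_damping_operator hΩ hΩb hg
  obtain ⟨σ, hσ, hσ1, hσA, hL, hLδ⟩ := exists_balanced_parameter hJ.α_pos hJ.α_lt_one hδ hδ1
  have hctrl := fun u v => damping_operator_control hΩ hΩb hG
    (fun x hx v w => damping_pointwise hg hJ hσ hσ1 hx v w) u v
  set τ : Hdiv Ω →L[ℝ] L2v Ω := T.comp (fldL Ω) with hτ
  have hτa : ∀ v, τ v = T (fld v) := fun v => rfl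
  obtain ⟨Q, hQV, hQd, hQle, hQQ, hQo⟩ := exists_divergence_splitting Vh hTl
  simp only [← hτa] at hQle hQQ hQo
  -- the error and its time derivatives
  have hVcl : IsClosed (Vh : Set (Hdiv Ω)) := Vh.closed_of_finiteDimensional
  have dφ := hφ.deriv_one.of_coe
  have dφ₁ := hφ.deriv_two.of_coe
  have dφh := hφh.deriv_one.of_coe
  have dφh₁ := hφh.deriv_two.of_coe
  have dθ := (dφ.clm P).sub dφh
  have dθ₁ := (dφ₁.clm P).sub dφh₁
  have hθV : ∀ s, 0 ≤ s → P (φ s) - φh s ∈ Vh := fun s hs =>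
    Vh.sub_mem (hpair.proj_mem _) (hφh.mem s hs)
  have hθ₁V := dθ.ae_mem hVcl hθV
  -- the coefficients
  set b := β / ε ^ 2 with hb
  have hbpos : 0 < b := by positivity
  set p := CP * √(1 / Hlo) with hp
  have hp0 : 0 ≤ p := by positivity
  set C₁ := const1 β Hlo fmax CP with hC₁
  set C₂ := const2 ε β Hlo Hhi CP with hC₂
  set K := 2 * M + (2 * C₀) ^ (1 / α) with hK
  set L := σ ^ (α - 1) with hLdef
  set A := δ ^ (2 * α / (2 - α)) with hA
  have hC₁0 : 0 < C₁ := const1_pos hβ hlo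
  have hC₂0 : 0 ≤ C₂ := const2_nonneg hβ hlo hhi
  have hM1 := hg.one_le hne
  have hK2 : 2 ≤ K := by
    have : 0 < (2 * C₀) ^ (1 / α) := Real.rpow_pos_of_pos (by linarith [hJ.C₀_pos]) _
    linarith
  have hA0 : 0 < A := by positivity
  set N := 3 / 2 * K * L with hN
  set Λ := (C₁ + C₂) * N with hΛ
  set ν := p / √b with hν
  have hν0 : 0 ≤ ν := by positivity
  have hN3 : 3 ≤ N := by
    have : 2 * 1 ≤ K * L := mul_le_mul hK2 hL zero_le_one (by linarith)
    rw [hN]; linarith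
  have hBν : 3 * ν ≤ C₁ + C₂ := three_mul_le_const hε hβ hlo hcoef.lo_le_hi
  have hB0 : 0 < C₁ + C₂ := by linarith
  have hΛ3 : 3 * (C₁ + C₂) ≤ Λ := by
    rw [hΛ, mul_comm 3]
    exact mul_le_mul_of_nonneg_left hN3 hB0.le
  have hΩ0 : 0 ≤ volume.real Ω := measureReal_nonneg
  set C := C₂ * δ ^ 2 + (C₁ + C₂) * (3 / 2 * σ ^ α * volume.real Ω)
    + 1 / 2 * √Hhi ^ 2 * (Λ * δ) ^ 2 with hC
  have hC0 : 0 ≤ C := by positivity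
  have hCle : C ≤ 9 / 4 * const3 Ω ε β Hlo Hhi fmax CP M C₀ α * A := by
    have h1 : (Λ * δ) ^ 2 = 9 / 4 * (C₁ + C₂) ^ 2 * K ^ 2 * A := by
      rw [← hLδ, hΛ, hN]; ring
    have h2 : δ ^ 2 ≤ A := by
      rw [← hLδ]
      exact le_mul_of_one_le_left (sq_nonneg δ) (one_le_pow₀ hL)
    have h3 : const3 Ω ε β Hlo Hhi fmax CP M C₀ α
        = C₂ + (C₁ + C₂) * volume.real Ω + Hhi / 2 * (C₁ + C₂) ^ 2 * K ^ 2 := rfl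
    rw [hC, h1, h3, hσA, Real.sq_sqrt hhi.le]
    have h4 := mul_le_mul_of_nonneg_left h2 hC₂0
    have h5 : 0 ≤ C₂ * A := by positivity
    have h6 : 0 ≤ (C₁ + C₂) * volume.real Ω * A := by positivity
    linarith
  -- norms of the splitting
  have hq : ∀ s, 0 ≤ s → ‖τ (Q (P (φ s) - φh s))‖ ≤ p * ‖dvg (P (φ s) - φh s)‖ := fun s hs => by
    rw [← hQd (P (φ s) - φh s)]
    exact hPF.norm_le hcoef hCP hT (hQV _ (hθV s hs)) fun r hr hr0 => hQo _ r hr hr0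
  have hwn : ∀ u : Hdiv Ω, ‖fld u‖ ≤ √Hhi * ‖τ u‖ := fun u => by
    refine le_of_sq_le_sq ?_ (by positivity)
    rw [mul_pow, Real.sq_sqrt hhi.le]
    exact hTl _
  have he : ∀ s, energy H ε β (P (φ₁ s) - φh₁ s) (P (φ s) - φh s)
      = 1 / 2 * ‖τ (P (φ₁ s) - φh₁ s)‖ ^ 2 + b / 2 * ‖dvgL Ω (P (φ s) - φh s)‖ ^ 2 := fun s => by
    rw [energy, hT, real_inner_self_eq_norm_sq, hb, hτa, dvgL_apply]
    congr 2
    field_simp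
  have key := energy_le_of_lyapunov τ (dvgL Ω) Q dθ dθ₁ (b := b) (ν := ν) (Λ := Λ) (C := C) he hν0
    (by linarith) hC0 (fun s hs => by
      rw [he]
      exact mul_le_energy hbpos hp0 (norm_nonneg _) (norm_nonneg _) (hQle _) (hq s hs)) (by
      filter_upwards [hφ.eqn, hφh.eqn, hres, hθ₁V, ae_restrict_mem measurableSet_Ici]
        with s e₁ e₂ hs hV₁ hs0
      have hR := (norm_residual_le hε hlo hcoef.fmax_nonneg hg.M_pos hpair hTn hSn
        (damping_operator_lipschitz hΩ hg hG) hs.1 hs.2.1).trans hs.2.2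
      have q₁ := error_equation hpair hT hTs hS hG hV₁ (e₁ _ trivial) (e₂ _ hV₁)
      have hQV' := hQV _ (hθV s hs0)
      have q₂ := error_equation hpair hT hTs hS hG hQV' (e₁ _ trivial) (e₂ _ hQV')
      have hq' := hq s hs0
      set R := T (T (fld (P (φ₂ s) - φ₂ s))) + T (S (T (fld (P (φ₁ s) - φ₁ s))))
        + (G (fld (P (φ₁ s))) - G (fld (φ₁ s)))
      have hct := hctrl (fld (P (φ₁ s))) (fld (φh₁ s))
      rw [← fld_sub] at hct
      set Γ := G (fld (P (φ₁ s))) - G (fld (φh₁ s))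
      simp only [← hτa] at q₁ q₂
      rw [hSk, add_zero] at q₁
      rw [hQQ, hQd, real_inner_self_eq_norm_sq] at q₂
      simp only [dvgL_apply]
      rw [he, dvgL_apply]
      have hδ0 := hδ.le
      refine dissipation_inequality (c₀ := fmax / ε) (δ := δ) (w := √Hhi) (p := p) (C₁ := C₁)
        (C₂ := C₂) (N := N) (Γ := ‖Γ‖) (m := ‖fld (P (φ₁ s) - φh₁ s)‖)
        (q := ‖τ (Q (P (φ s) - φh s))‖) (r := inner ℝ R (fld (P (φ₁ s) - φh₁ s)))
        (r' := inner ℝ R (fld (Q (P (φ s) - φh s)))) (D := inner ℝ Γ (fld (P (φ₁ s) - φh₁ s)))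
        hbpos (Real.sqrt_nonneg _) (div_nonneg hcoef.fmax_nonneg hε.le) hδ0 (norm_nonneg _)
        (norm_nonneg _) (norm_nonneg _) rfl (const2_eq hε hβ hlo hhi) ?_ hC₁0.le hC₂0
        (by positivity) rfl hq' (hQle _) ?_ ?_ ?_ ?_ hct q₁ q₂
      · rw [hC₁, const1_eq hε hβ hlo]
        exact (mul_le_mul_of_nonneg_left (hTn (fld (P (φ₁ s) - φh₁ s)))
          (by positivity)).trans_eq (by ring)
      · refine (neg_le_abs _).trans ((abs_real_inner_le_norm _ _).trans ?_)
        exact mul_le_mul_of_nonneg_right (hSn _) (norm_nonneg _)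
      · refine (neg_le_abs _).trans ((abs_real_inner_le_norm _ _).trans ?_)
        rw [mul_assoc]
        exact mul_le_mul_of_nonneg_left (hwn _) (norm_nonneg _)
      · refine (real_inner_le_norm _ _).trans ?_
        rw [mul_assoc]
        exact mul_le_mul hR (hwn _) (norm_nonneg _) hδ0
      · refine (real_inner_le_norm _ _).trans ?_
        rw [mul_assoc]
        exact mul_le_mul hR (hwn _) (norm_nonneg _) hδ0) hE0 ht
  -- `Λ ≥ 9 ν` leaves a ratio of at most `4 / 3`
  have h1 : 0 < Λ - ν := by linarith
  have h2 : (Λ + ν) * C ≤ (Λ - ν) * (4 / 3 * C) := by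
    have h3 : (Λ - ν) * (4 / 3 * C) - (Λ + ν) * C = 1 / 3 * (Λ - 7 * ν) * C := by ring
    have h4 : 0 ≤ 1 / 3 * (Λ - 7 * ν) * C := mul_nonneg (by linarith) hC0
    linarith
  have h5 := le_of_mul_le_mul_left (key.trans h2) h1
  linarith

lemma energy_empty {H : E2 → ℝ} {ε β : ℝ} (v θ : Hdiv ∅) : energy H ε β v θ = 0 := by
  have h1 : dvg θ = 0 :=
    Lp.ext (ae_restrict_of_forall_mem MeasurableSet.empty fun x hx => hx.elim)
  simp [energy, winner, h1]

/-- Velocity and elevation errors, split into projection errors and the energy of the discrete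
error. -/
lemma half_sq_add_le {Ω : Set E2} {ε β Hhi n y : ℝ} (hε : 0 < ε) (hβ : 0 < β)
    {u uh pu : L2v Ω} {η ηh pη : L2s Ω} (h₁ : ‖pu - uh‖ ^ 2 ≤ Hhi * n ^ 2)
    (h₂ : ‖pη - ηh‖ = y) :
    1 / 2 * ‖u - uh‖ ^ 2 + β / (2 * ε) * ‖η - ηh‖ ^ 2
      ≤ ‖pu - u‖ ^ 2 + β / ε * ‖pη - η‖ ^ 2
        + 2 * max Hhi ε * (1 / 2 * n ^ 2 + β / (2 * ε ^ 2) * y ^ 2) := by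
  have key : ∀ {V : Type} [NormedAddCommGroup V] (a b c : V),
      1 / 2 * ‖a - b‖ ^ 2 ≤ ‖c - a‖ ^ 2 + ‖c - b‖ ^ 2 := by
    intro V _ a b c
    have h1 : ‖a - b‖ ≤ ‖c - a‖ + ‖c - b‖ := by
      rw [← norm_neg (c - a), neg_sub]
      calc ‖a - b‖ = ‖(a - c) + (c - b)‖ := by rw [sub_add_sub_cancel]
        _ ≤ _ := norm_add_le _ _
    have h2 := pow_le_pow_left₀ (norm_nonneg _) h1 2
    nlinarith [sq_nonneg (‖c - a‖ - ‖c - b‖)]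
  have k₁ := key u uh pu
  have k₂ := key η ηh pη
  rw [h₂] at k₂
  have m₁ := mul_le_mul_of_nonneg_right (le_max_left Hhi ε) (sq_nonneg n)
  have hc : 0 ≤ β / ε ^ 2 * y ^ 2 := by positivity
  have m₂ := mul_le_mul_of_nonneg_right (le_max_right Hhi ε) hc
  have m₃ := mul_le_mul_of_nonneg_left k₂ (div_nonneg hβ.le hε.le)
  have e₁ : ε * (β / ε ^ 2 * y ^ 2) = β / ε * y ^ 2 := by field_simp
  have e₂ : β / (2 * ε) * ‖η - ηh‖ ^ 2 = β / ε * (1 / 2 * ‖η - ηh‖ ^ 2) := by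
    field_simp
  have e₃ : 2 * max Hhi ε * (1 / 2 * n ^ 2 + β / (2 * ε ^ 2) * y ^ 2)
      = max Hhi ε * n ^ 2 + max Hhi ε * (β / ε ^ 2 * y ^ 2) := by
    field_simp
  rw [e₂, e₃]
  rw [e₁] at m₂
  linarith

lemma nonpos_of_le_mul_rpow {x c p : ℝ} (hp : 0 < p)
    (h : ∀ δ : ℝ, 0 < δ → δ ≤ 1 → x ≤ c * δ ^ p) : x ≤ 0 := by
  have hlim : Tendsto (fun δ : ℝ => c * δ ^ p) (𝓝[>] 0) (𝓝 (c * 0 ^ p)) :=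
    ((Real.continuousAt_rpow_const 0 p (Or.inr hp.le)).tendsto.mono_left
      nhdsWithin_le_nhds).const_mul _
  rw [Real.zero_rpow hp.ne', mul_zero] at hlim
  refine ge_of_tendsto hlim ?_
  filter_upwards [Ioc_mem_nhdsGT (zero_lt_one (α := ℝ))] with δ hδ
  exact h δ hδ.1 hδ.2

end Tide

theorem mainTheorem4
    -- domain and coefficients
    (Ω : Set Tide.E2) (hΩ : IsOpen Ω) (hΩb : Bornology.IsBounded Ω)
    (H f : Tide.E2 → ℝ) (Hlo Hhi fmax ε β : ℝ) (hε : 0 < ε) (hβ : 0 < β)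
    (hcoef : Tide.CoeffBounds Ω H f Hlo Hhi fmax)
    -- damping
    (g : Tide.E2 → Tide.E2 → Tide.E2) (M : ℝ) (hg : Tide.Damping Ω g M)
    (J : ℝ → ℝ) (C₀ α : ℝ) (hJ : Tide.DampingProfile Ω g J C₀ α)
    -- discretization
    (k : ℕ) (h Cproj Cscal CP : ℝ)
    (Vh : Submodule ℝ (Tide.Hdiv Ω)) [FiniteDimensional ℝ Vh]
    (Wh : Submodule ℝ (Tide.L2s Ω)) [FiniteDimensional ℝ Wh]
    (P : Tide.Hdiv Ω →L[ℝ] Tide.Hdiv Ω)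
    (hpair : Tide.MixedPair k h Vh Wh P Cproj Cscal)
    (hCP : 0 < CP) (hPF : Tide.PoincareFriedrichs H Vh CP)
    -- exact and semidiscrete solutions, with their first and second time derivatives
    (F : ℝ → Tide.L2v Ω)
    (φ φ₁ φ₂ φh φh₁ φh₂ : ℝ → Tide.Hdiv Ω)
    (hφ : Tide.IsSolution ⊤ H f ε β g F φ φ₁ φ₂)
    (hφh : Tide.IsSolution Vh H f ε β g F φh φh₁ φh₂)
    -- regularity of the exact solution
    (hreg : Tide.LinftyHk k (fun t => Tide.fld (φ t)))
    (hreg₁ : Tide.LinftyHk k (fun t => Tide.fld (φ₁ t)))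
    (κ : ℝ)
    (hκ : ∀ᵐ t ∂(MeasureTheory.volume.restrict (Set.Ici (0 : ℝ))),
      Tide.VMemHk k (Tide.fld (φ₁ t)) ∧ Tide.VMemHk k (Tide.fld (φ₂ t)) ∧
      Tide.kappa k ε Hlo fmax M Cproj (Tide.fld (φ₁ t)) (Tide.fld (φ₂ t)) ≤ κ)
    (hsmall : κ * h ^ k ≤ 1)
    -- the error energy, which vanishes initially
    (E : ℝ → ℝ)
    (hE : ∀ t, E t = Tide.energy H ε β (P (φ₁ t) - φh₁ t) (P (φ t) - φh t))
    (hE0 : E 0 = 0)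
    -- velocities, elevations and their projection errors
    (u uh χ : ℝ → Tide.L2v Ω) (η ηh ρ : ℝ → Tide.L2s Ω)
    (hu : ∀ t, u t = Tide.fld (φ₁ t)) (huh : ∀ t, uh t = Tide.fld (φh₁ t))
    (hη : ∀ t, η t = -Tide.dvg (φ t)) (hηh : ∀ t, ηh t = -Tide.dvg (φh t))
    (hχ : ∀ t, χ t = Tide.fld (P (φ₁ t)) - u t)
    (hρ : ∀ t, ρ t = Wh.starProjection (η t) - η t)
    (C₃ : ℝ) (hC₃ : C₃ = Tide.const3 Ω ε β Hlo Hhi fmax CP M C₀ α) :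
    -- the error energy is bounded uniformly in time
    (∀ t : ℝ, 0 ≤ t →
      E t ≤ 3 * C₃ * κ ^ (2 * α / (2 - α)) * h ^ (2 * k * α / (2 - α))) ∧
    -- the errors of velocity and elevation
    (∀ t : ℝ, 0 ≤ t →
      1 / 2 * ‖u t - uh t‖ ^ 2 + β / (2 * ε) * ‖η t - ηh t‖ ^ 2
        ≤ ‖χ t‖ ^ 2 + β / ε * ‖ρ t‖ ^ 2 + 2 * max Hhi ε * E t) ∧
    (∀ t : ℝ, 0 ≤ t → Tide.VMemHk k (u t)) ∧
    (∀ t : ℝ, 0 ≤ t → Tide.MemHk k (η t) →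
      ‖χ t‖ ^ 2 + β / ε * ‖ρ t‖ ^ 2 + 2 * max Hhi ε * E t
        ≤ (Cproj ^ 2 * Tide.vseminormHk k (u t) ^ 2
            + β / ε * Cscal ^ 2 * Tide.seminormHk k (η t) ^ 2) * h ^ (2 * k)
          + 6 * max Hhi ε * C₃ * κ ^ (2 * α / (2 - α)) * h ^ (2 * k * α / (2 - α))) ∧
    -- the example: order `√h` for lowest order and `α = 2/3`, which is admissible for quadratic damping
    (k = 1 → α = 2 / 3 → h ≤ 1 →
      ∀ t : ℝ, 0 ≤ t → Tide.MemHk k (η t) →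
        Real.sqrt (1 / 2 * ‖u t - uh t‖ ^ 2 + β / (2 * ε) * ‖η t - ηh t‖ ^ 2)
          ≤ Real.sqrt (Cproj ^ 2 * Tide.vseminormHk k (u t) ^ 2
              + β / ε * Cscal ^ 2 * Tide.seminormHk k (η t) ^ 2 + 6 * max Hhi ε * C₃ * κ)
            * Real.sqrt h) ∧
    (∃ (M' C₀' : ℝ) (J' : ℝ → ℝ), Tide.Damping Ω Tide.quadraticDrag M' ∧
      Tide.DampingProfile Ω Tide.quadraticDrag J' C₀' (2 / 3)) := by
  have hlo := hcoef.lo_pos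
  have hhi : 0 < Hhi := hlo.trans_le hcoef.lo_le_hi
  have hhpos := hpair.h_pos
  have hα := hJ.α_pos
  have hα1 := hJ.α_lt_one
  have hκ0 : 0 ≤ κ := by
    have : (ae (volume.restrict (Ici (0 : ℝ)))).NeBot := by
      rw [ae_neBot, Ne, Measure.restrict_eq_zero, Real.volume_Ici]
      exact ENNReal.top_ne_zero
    obtain ⟨s, -, -, hs⟩ := hκ.exists
    exact (Tide.kappa_nonneg hε hlo hcoef.fmax_nonneg hg.M_pos hpair.Cproj_pos _ _).trans hs
  have hC₃0 : 0 ≤ C₃ := hC₃ ▸ Tide.const3_nonneg hβ hlo hhi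
  set p := 2 * α / (2 - α) with hp
  have hp0 : 0 < p := by
    have : 0 < 2 - α := by linarith
    positivity
  have hpow : (κ * h ^ k) ^ p = κ ^ p * h ^ (2 * k * α / (2 - α)) := by
    rw [Real.mul_rpow hκ0 (by positivity), ← Real.rpow_natCast h k, ← Real.rpow_mul hhpos.le]
    congr 2
    rw [hp]; ring
  have hbound : ∀ t : ℝ, 0 ≤ t → E t ≤ 3 * C₃ * (κ * h ^ k) ^ p := by
    intro t ht
    rw [hE] at hE0
    rcases Ω.eq_empty_or_nonempty with rfl | hne
    · rw [hE, Tide.energy_empty]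
      positivity
    have hδ : ∀ δ : ℝ, 0 < δ → δ ≤ 1 → κ * h ^ k ≤ δ → E t ≤ 3 * C₃ * δ ^ p := by
      intro δ hδ0 hδ1 hle
      rw [hE, hC₃]
      refine Tide.error_energy_le hΩ hΩb hne hε hβ hcoef hg hJ hpair hCP hPF hφ hφh hδ0 hδ1 ?_
        hE0 ht
      filter_upwards [hκ] with s hs
      exact ⟨hs.1, hs.2.1, (mul_le_mul_of_nonneg_right hs.2.2 (by positivity)).trans hle⟩
    rcases (mul_nonneg hκ0 (by positivity : 0 ≤ h ^ k)).eq_or_lt with h0 | h0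
    · -- a vanishing residual bound is the limit of positive ones
      rw [← h0] at hδ ⊢
      rw [Real.zero_rpow hp0.ne', mul_zero]
      exact Tide.nonpos_of_le_mul_rpow hp0 fun δ h1 h2 => hδ δ h1 h2 h1.le
    · exact hδ _ h0 hsmall le_rfl
  have hmax : 0 ≤ max Hhi ε := hhi.le.trans (le_max_left _ _)
  have hsplit : ∀ t : ℝ, 0 ≤ t →
      1 / 2 * ‖u t - uh t‖ ^ 2 + β / (2 * ε) * ‖η t - ηh t‖ ^ 2
        ≤ ‖χ t‖ ^ 2 + β / ε * ‖ρ t‖ ^ 2 + 2 * max Hhi ε * E t := by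
    intro t _
    obtain ⟨T, S, hT, -, -, hTl, -⟩ := Tide.exists_weight_operators hε hcoef
    rw [hχ, hρ, hE, Tide.energy, hT, real_inner_self_eq_norm_sq]
    refine Tide.half_sq_add_le hε hβ ?_ ?_
    · rw [huh, ← Tide.fld_sub]
      exact hTl _
    · rw [hη, hηh, map_neg, ← hpair.dvg_proj, Tide.dvg_sub, neg_sub_neg, norm_sub_rev]
  have hmem : ∀ t : ℝ, 0 ≤ t → Tide.VMemHk k (u t) := by
    intro t ht
    rw [hu]
    exact hreg₁.vmemHk (v := fun t => Tide.fld (φ₁ t))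
      ((Tide.fldL Ω).continuous.comp_continuousOn hφ.deriv_two.of_coe.continuousOn) ht
  have hfull : ∀ t : ℝ, 0 ≤ t → Tide.MemHk k (η t) →
      ‖χ t‖ ^ 2 + β / ε * ‖ρ t‖ ^ 2 + 2 * max Hhi ε * E t
        ≤ (Cproj ^ 2 * Tide.vseminormHk k (u t) ^ 2
            + β / ε * Cscal ^ 2 * Tide.seminormHk k (η t) ^ 2) * h ^ (2 * k)
          + 6 * max Hhi ε * C₃ * κ ^ p * h ^ (2 * k * α / (2 - α)) := by
    intro t ht hηt
    have h₁ : ‖χ t‖ ≤ Cproj * h ^ k * Tide.vseminormHk k (u t) := by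
      have h := hpair.approx (φ₁ t) (hu t ▸ hmem t ht)
      rwa [norm_sub_rev, ← hu, ← hχ] at h
    have h₂ : ‖ρ t‖ ≤ Cscal * h ^ k * Tide.seminormHk k (η t) := by
      have e : Tide.dvg (-φ t) = η t := by rw [Tide.dvg_neg, hη]
      have h := hpair.approx_dvg (-φ t) (e ▸ hηt)
      rwa [e, norm_sub_rev, ← hρ] at h
    have s₁ := pow_le_pow_left₀ (norm_nonneg _) h₁ 2
    have s₂ := mul_le_mul_of_nonneg_left (pow_le_pow_left₀ (norm_nonneg _) h₂ 2)
      (div_nonneg hβ.le hε.le)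
    have s₃ := mul_le_mul_of_nonneg_left (hbound t ht)
      (mul_nonneg zero_le_two hmax)
    rw [hpow] at s₃
    have e₁ : (h ^ k) ^ 2 = h ^ (2 * k) := by rw [← pow_mul, mul_comm]
    rw [← e₁]
    linarith
  refine ⟨fun t ht => ?_, hsplit, hmem, hfull, ?_, 2, 5 * 2 ^ (2 / 3 : ℝ), _,
    Tide.quadraticDrag_damping Ω, Tide.quadraticDrag_profile Ω⟩
  · rw [mul_assoc, ← hpow]
    exact hbound t ht
  · intro hk hα23 hh1 t ht hηt
    have h₁ := (hsplit t ht).trans (hfull t ht hηt)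
    have hp1 : p = 1 := by rw [hp, hα23]; norm_num
    have he : 2 * (k : ℝ) * α / (2 - α) = 1 := by rw [hk, hα23]; norm_num
    rw [hp1, he, Real.rpow_one, Real.rpow_one] at h₁
    rw [← Real.sqrt_mul' _ hhpos.le]
    refine Real.sqrt_le_sqrt (h₁.trans ?_)
    have h₂ : h ^ (2 * k) ≤ h := by
      rw [hk]
      exact pow_le_of_le_one hhpos.le hh1 (by norm_num)
    have h₃ : 0 ≤ Cproj ^ 2 * Tide.vseminormHk k (u t) ^ 2
        + β / ε * Cscal ^ 2 * Tide.seminormHk k (η t) ^ 2 := by positivity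
    have h₄ := mul_le_mul_of_nonneg_left h₂ h₃
    linarith
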